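/- Let $k$ be a field and let $H$ be a weak Hopf algebra over $k$: a unital associative algebra and coassociative counital coalgebra with $\Delta(hl)=\Delta(h)\Delta(l)$, $\Delta^2(1)=1^{(1)}\otimes 1^{(2)}1^{(1')}\otimes 1^{(2')}=1^{(1)}\otimes 1^{(1')}1^{(2)}\otimes 1^{(2')}$ and $\epsilon(hlm)=\epsilon(hl^{(1)})\epsilon(l^{(2)}m)=\epsilon(hl^{(2)})\epsilon(l^{(1)}m)$ for all $h,l,m\in H$, with an antipode $S$, that is, a linear map with $h^{(1)}S(h^{(2)})=\Pi^L(h)$, $S(h^{(1)})h^{(2)}=\Pi^R(h)$ and $S(h^{(1)})h^{(2)}S(h^{(3)})=S(h)$. Here $\Pi^L(h):=\epsilon(1^{(1)}h)1^{(2)}$, $\Pi^R(h):=1^{(1)}\epsilon(h1^{(2)})$, and we also set $\overline{\Pi}^R(h):=\epsilon(h1^{(1)})1^{(2)}$. Let $H^L:=\operatorname{Im}\Pi^L$ (a subalgebra of $H$), let $H^R:=\operatorname{Im}\Pi^R$, a right $H$-module via $l\cdot h:=\Pi^R(lh)$, and let $\overline H:=H/H^L$, an $H^L$-bimodule; write $\overline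 h$ for the class of $h$ in $\overline H$ and $\overline{\mathbf h}_{ij}:=\overline{h_i}\otimes_{H^L}\cdots\otimes_{H^L}\overline{h_j}$. (1) For each left $H$-module $N$ there are well defined $k$-linear maps $d_s\colon \overline H^{\otimes_{H^L}^{s}}\otimes_{H^L}N\to \overline H^{\otimes_{H^L}^{s-1}}\otimes_{H^L}N$ ($s\ge 1$; for $s=1$ the target is $N$) given by $d_1(\overline{h_1}\otimes n)=\overline\Pi^R(h_1)\cdot n-h_1\cdot n$ and, for $s\ge 2$, $$d_s(\overline{\mathbf h}_{1s}\otimes n)=\overline{\overline\Pi^R(h_1)h_2}\otimes\overline{\mathbf h}_{3s}\otimes n+\sum_{i=1}^{s-1}(-1)^i\,\overline{\mathbf h}_{1,i-1}\otimes\overline{h_ih_{i+1}}\otimes\overline{\mathbf h}_{i+2,s}\otimes n+(-1)^s\,\overline{\mathbf h}_{1,s-1}\otimes h_s\cdot n,$$ and $d_s\circ d_{s+1}=0$. For $N=H$ these maps, denoted $d'_s$, are right $H$-linear, and $$H^R\xleftarrow{\ \Pi^R\ }H\xleftarrow{\ d'_1\ }\overline H\otimes_{H^L}H\xleftarrow{\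 d'_2\ }\overline H^{\otimes_{H^L}^2}\otimes_{H^L}H\xleftarrow{\ d'_3\ }\cdots$$ is a chain complex of right $H$-modules, which is contractible as a complex of right $H^L$-modules. The right $H$-modules $\overline H^{\otimes_{H^L}^s}\otimes_{H^L}H$ ($s\ge 0$) are projective and the complex is exact; so it is a projective resolution of the right $H$-module $H^R$. (2) Let $N$ be a left $H$-module. The homology $\mathrm H_n(H,N):=\operatorname{Tor}_n^H(H^R,N)$ is, for each $n\ge 0$, the $n$-th homology of the complex $$N\xleftarrow{\ d_1\ }\overline H\otimes_{H^L}N\xleftarrow{\ d_2\ }\overline H^{\otimes_{H^L}^2}\otimes_{H^L}N\xleftarrow{\ d_3\ }\cdots ,$$ by an isomorphism of vector spaces that is natural in $N$. (3) Let $N$ be a right $H$-module. There are well defined $k$-linear maps $d^1\colon N\to\operatorname{Hom}_{H^L}(\overline H,N)$ and $d^s\colon\operatorname{Hom}_{H^L}(\overline H^{\otimes_{H^L}^{s-1}},N)\to\operatorname{Hom}_{H^L}(\overline H^{\otimes_{H^L}^{s}},N)$, $s\ge 2$ (homomorphisms of right $H^L$-modules), given by $d^1(n)(\overline{h_1})=n\cdot\overline\Pi^R(h_1)-n\cdot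 h_1$ and, for $s\ge 2$, $$d^s(\beta)(\overline{\mathbf h}_{1s})=\beta\bigl(\overline{\overline\Pi^R(h_1)h_2}\otimes\overline{\mathbf h}_{3s}\bigr)+\sum_{i=1}^{s-1}(-1)^i\beta\bigl(\overline{\mathbf h}_{1,i-1}\otimes\overline{h_ih_{i+1}}\otimes\overline{\mathbf h}_{i+2,s}\bigr)+(-1)^s\beta(\overline{\mathbf h}_{1,s-1})\cdot h_s .$$ They form a cochain complex $N\to\operatorname{Hom}_{H^L}(\overline H,N)\to\operatorname{Hom}_{H^L}(\overline H^{\otimes_{H^L}^2},N)\to\cdots$, whose $n$-th cohomology is, for each $n\ge 0$, the cohomology $\mathrm H^n(H,N):=\operatorname{Ext}^n_H(H^R,N)$, by an isomorphism of vector spaces that is natural in $N$. -/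

import Mathlib

open scoped TensorProduct
open CategoryTheory MulOpposite

universe u

/-! ### Weak bialgebras and weak Hopf algebras -/

/-- A weak bialgebra over the field `k`: an algebra and coalgebra whose comultiplication is
multiplicative, with the weak axioms for the unit and the counit. -/
class WeakBialgebra (k H : Type u) [Field k] [Ring H] [Algebra k H] extends Coalgebra k H where
  /-- `Δ(gh) = Δ(g)Δ(h)` -/
  comul_mul : ∀ g h : H, comul (g * h) = comul g * comul h
  /-- `Δ²(1) = 1⁽¹⁾ ⊗ 1⁽²⁾1⁽¹'⁾ ⊗ 1⁽²'⁾` -/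
  comul_one_left : comul.lTensor H (comul (1 : H)) =
    TensorProduct.assoc k H H H (comul (1 : H) ⊗ₜ[k] (1 : H)) * ((1 : H) ⊗ₜ[k] comul (1 : H))
  /-- `Δ²(1) = 1⁽¹⁾ ⊗ 1⁽¹'⁾1⁽²⁾ ⊗ 1⁽²'⁾` -/
  comul_one_right : comul.lTensor H (comul (1 : H)) =
    ((1 : H) ⊗ₜ[k] comul (1 : H)) * TensorProduct.assoc k H H H (comul (1 : H) ⊗ₜ[k] (1 : H))
  /-- `ε(hlm) = ε(hl⁽¹⁾)ε(l⁽²⁾m)` -/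
  counit_mul_left : ∀ h l m : H, counit (h * l * m) =
    LinearMap.mul' k k (TensorProduct.map (counit ∘ₗ LinearMap.mulLeft k h)
      (counit ∘ₗ LinearMap.mulRight k m) (comul l))
  /-- `ε(hlm) = ε(l⁽¹⁾m)ε(hl⁽²⁾)` -/
  counit_mul_right : ∀ h l m : H, counit (h * l * m) =
    LinearMap.mul' k k (TensorProduct.map (counit ∘ₗ LinearMap.mulRight k m)
      (counit ∘ₗ LinearMap.mulLeft k h) (comul l))

namespace WeakHopf

section Projections

variable (k H : Type u) [Field k] [Ring H] [Algebra k H] [WeakBialgebra k H]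

local notation "Δ" => (CoalgebraStruct.comul : H →ₗ[k] H ⊗[k] H)
local notation "ε" => (CoalgebraStruct.counit : H →ₗ[k] k)

/-- `Π^L(h) = ε(1⁽¹⁾h)1⁽²⁾` -/
noncomputable def piL : H →ₗ[k] H where
  toFun h := TensorProduct.lid k H ((ε ∘ₗ LinearMap.mulRight k h).rTensor H (Δ 1))
  map_add' x y := by
    have : ε ∘ₗ LinearMap.mulRight k (x + y) =
        ε ∘ₗ LinearMap.mulRight k x + ε ∘ₗ LinearMap.mulRight k y := by
      ext; simp [mul_add]
    rw [this, LinearMap.rTensor_add]; simp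
  map_smul' c x := by
    have : ε ∘ₗ LinearMap.mulRight k (c • x) = c • (ε ∘ₗ LinearMap.mulRight k x) := by
      ext; simp
    rw [this, LinearMap.rTensor_smul]; simp

/-- `Π^R(h) = 1⁽¹⁾ε(h1⁽²⁾)` -/
noncomputable def piR : H →ₗ[k] H where
  toFun h := TensorProduct.rid k H ((ε ∘ₗ LinearMap.mulLeft k h).lTensor H (Δ 1))
  map_add' x y := by
    have : ε ∘ₗ LinearMap.mulLeft k (x + y) =
        ε ∘ₗ LinearMap.mulLeft k x + ε ∘ₗ LinearMap.mulLeft k y := by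
      ext; simp [add_mul]
    rw [this, LinearMap.lTensor_add]; simp
  map_smul' c x := by
    have : ε ∘ₗ LinearMap.mulLeft k (c • x) = c • (ε ∘ₗ LinearMap.mulLeft k x) := by
      ext; simp
    rw [this, LinearMap.lTensor_smul]; simp

/-- `Π̄^R(h) = ε(h1⁽¹⁾)1⁽²⁾` -/
noncomputable def piBarR : H →ₗ[k] H where
  toFun h := TensorProduct.lid k H ((ε ∘ₗ LinearMap.mulLeft k h).rTensor H (Δ 1))
  map_add' x y := by
    have : ε ∘ₗ LinearMap.mulLeft k (x + y) =
        ε ∘ₗ LinearMap.mulLeft k x + ε ∘ₗ LinearMap.mulLeft k y := by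
      ext; simp [add_mul]
    rw [this, LinearMap.rTensor_add]; simp
  map_smul' c x := by
    have : ε ∘ₗ LinearMap.mulLeft k (c • x) = c • (ε ∘ₗ LinearMap.mulLeft k x) := by
      ext; simp
    rw [this, LinearMap.rTensor_smul]; simp

variable {k H}

lemma comul_piL (h : H) : Δ (piL k H h) = (piL k H h ⊗ₜ[k] (1 : H)) * Δ 1 := by
  have key := congrArg (fun t => TensorProduct.lid k (H ⊗[k] H)
    ((ε ∘ₗ LinearMap.mulRight k h).rTensor (H ⊗[k] H) t))
    (WeakBialgebra.comul_one_left (k := k) (H := H))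
  have h1 : TensorProduct.lid k (H ⊗[k] H)
      ((ε ∘ₗ LinearMap.mulRight k h).rTensor (H ⊗[k] H) (LinearMap.lTensor H Δ (Δ 1))) =
      Δ (piL k H h) := by
    simp only [piL, LinearMap.coe_mk, AddHom.coe_mk]
    generalize Δ 1 = t
    induction t with
    | zero => simp
    | add x y hx hy => simp only [map_add, hx, hy]
    | tmul x y => simp
  have aux (t t' : H ⊗[k] H) : TensorProduct.lid k (H ⊗[k] H)
      ((ε ∘ₗ LinearMap.mulRight k h).rTensor (H ⊗[k] H)
        (TensorProduct.assoc k H H H (t ⊗ₜ[k] (1 : H)) * ((1 : H) ⊗ₜ[k] t'))) =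
      (TensorProduct.lid k H ((ε ∘ₗ LinearMap.mulRight k h).rTensor H t) ⊗ₜ[k] (1 : H)) * t' := by
    induction t with
    | zero => simp
    | add x y hx hy => simp only [TensorProduct.add_tmul, map_add, add_mul, hx, hy]
    | tmul x y =>
      induction t' with
      | zero => simp
      | add x y hx hy => simp only [TensorProduct.tmul_add, map_add, mul_add, hx, hy]
      | tmul a b => simp [TensorProduct.smul_tmul']
  rw [← h1, key]
  exact aux _ _

lemma piBarR_of_comul {x : H} (hx : Δ x = (x ⊗ₜ[k] (1 : H)) * Δ 1) : piBarR k H x = x := by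
  have h1 := Coalgebra.rTensor_counit_comul (R := k) x
  rw [hx] at h1
  have h2 := congrArg (TensorProduct.lid k H) h1
  rw [TensorProduct.lid_tmul, one_smul] at h2
  refine Eq.trans ?_ h2
  simp only [piBarR, LinearMap.coe_mk, AddHom.coe_mk]
  generalize Δ 1 = t
  induction t with
  | zero => simp
  | add x y hx hy => simp only [map_add, mul_add, hx, hy]
  | tmul a b => simp

lemma piL_piBarR (x : H) : piL k H (piBarR k H x) = piBarR k H x := by
  obtain ⟨F, hF⟩ : ∃ F : H ⊗[k] (H ⊗[k] H) →ₗ[k] H,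
      ∀ (a b c : H), F (a ⊗ₜ (b ⊗ₜ c)) = ε (x * a) • ε b • c :=
    ⟨TensorProduct.lift ((LinearMap.lsmul k H).compl₂
      ((TensorProduct.lid k H).toLinearMap ∘ₗ LinearMap.rTensor H ε) ∘ₗ
        (ε ∘ₗ LinearMap.mulLeft k x)),
      fun a b c => by simp [smul_smul, mul_comm]⟩
  have h1 (t : H ⊗[k] H) : F (LinearMap.lTensor H Δ t) =
      TensorProduct.lid k H ((ε ∘ₗ LinearMap.mulLeft k x).rTensor H t) := by
    induction t with
    | zero => simp
    | add x y hx hy => simp only [map_add, hx, hy]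
    | tmul a b =>
      have h2 (u : H ⊗[k] H) : F (a ⊗ₜ u) =
          ε (x * a) • TensorProduct.lid k H (LinearMap.rTensor H ε u) := by
        induction u with
        | zero => simp
        | add x y hx hy => simp only [TensorProduct.tmul_add, map_add, smul_add, hx, hy]
        | tmul b c => simp [hF]
      rw [LinearMap.lTensor_tmul, h2, Coalgebra.rTensor_counit_comul]
      simp
  have aux (t t' : H ⊗[k] H) :
      F (((1 : H) ⊗ₜ[k] t') * TensorProduct.assoc k H H H (t ⊗ₜ[k] (1 : H))) =
      TensorProduct.lid k H ((ε ∘ₗ LinearMap.mulRight k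
        (TensorProduct.lid k H ((ε ∘ₗ LinearMap.mulLeft k x).rTensor H t))).rTensor H t') := by
    induction t' with
    | zero => simp
    | add x y hx hy => simp only [TensorProduct.tmul_add, map_add, add_mul, hx, hy]
    | tmul a b =>
      induction t with
      | zero => simp
      | add x y hx hy =>
        simp only [TensorProduct.add_tmul, map_add, mul_add, hx, hy]
        simp [mul_add, add_smul]
      | tmul c d => simp [smul_smul, hF]
  have h3 := aux (Δ 1) (Δ 1)
  rw [← WeakBialgebra.comul_one_right, h1] at h3
  exact h3.symm

lemma piR_mul (h g : H) : piR k H (piR k H h * g) = piR k H (h * g) := by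
  have key (b : H) : ε (h * (g * b)) = ε (piR k H h * (g * b)) := by
    have := WeakBialgebra.counit_mul_right (k := k) h 1 (g * b)
    rw [mul_one] at this
    rw [this]
    simp only [piR, LinearMap.coe_mk, AddHom.coe_mk]
    generalize Δ 1 = t
    induction t with
    | zero => simp
    | add x y hx hy => simp only [map_add, add_mul, hx, hy]
    | tmul x y => simp [mul_comm, mul_assoc]
  have : ε ∘ₗ LinearMap.mulLeft k (piR k H h * g) = ε ∘ₗ LinearMap.mulLeft k (h * g) := by
    ext b
    simpa [mul_assoc] using (key b).symm
  change TensorProduct.rid k H ((ε ∘ₗ LinearMap.mulLeft k (piR k H h * g)).lTensor H (Δ 1)) = _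
  rw [this]
  rfl

lemma piL_one : piL k H 1 = 1 := by
  have h1 := congrArg (TensorProduct.lid k H) (Coalgebra.rTensor_counit_comul (R := k) (1 : H))
  rw [TensorProduct.lid_tmul, one_smul] at h1
  refine Eq.trans ?_ h1
  have : ε ∘ₗ LinearMap.mulRight k 1 = ε := by ext; simp
  change TensorProduct.lid k H ((ε ∘ₗ LinearMap.mulRight k 1).rTensor H (Δ 1)) = _
  rw [this]

lemma mem_range_piL {x : H} :
    x ∈ LinearMap.range (piL k H) ↔ Δ x = (x ⊗ₜ[k] (1 : H)) * Δ 1 := by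
  constructor
  · rintro ⟨h, rfl⟩
    exact comul_piL h
  · intro hx
    exact ⟨x, by conv_lhs => rw [← piBarR_of_comul hx, piL_piBarR, piBarR_of_comul hx]⟩

variable (k H)

/-- The subalgebra `H^L = Im Π^L` of `H`. -/
noncomputable def HL : Subalgebra k H where
  carrier := Set.range (piL k H)
  mul_mem' {x y} hx hy := by
    have hx' : x ∈ LinearMap.range (piL k H) := hx
    have hy' : y ∈ LinearMap.range (piL k H) := hy
    change x * y ∈ LinearMap.range (piL k H)
    rw [mem_range_piL] at hx' hy' ⊢
    rw [WeakBialgebra.comul_mul, hx', mul_assoc, ← WeakBialgebra.comul_mul, one_mul, hy',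
      ← mul_assoc, Algebra.TensorProduct.tmul_mul_tmul, one_mul]
  add_mem' {x y} hx hy := (LinearMap.range (piL k H)).add_mem hx hy
  algebraMap_mem' r := ⟨algebraMap k H r, by
    rw [Algebra.algebraMap_eq_smul_one, map_smul, piL_one]⟩

/-- The subspace `H^R = Im Π^R` of `H`. -/
noncomputable def HR : Submodule k H := LinearMap.range (piR k H)

variable {k H} in
lemma piR_of_mem (x : HR k H) : piR k H x = x := by
  obtain ⟨_, h, rfl⟩ := x
  simpa using piR_mul (k := k) h 1

/-- The right `H`-module structure `l · h = Π^R(lh)` of `H^R`. -/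
noncomputable instance : Module Hᵐᵒᵖ (HR k H) where
  smul h l := ⟨piR k H (l * h.unop), _, rfl⟩
  one_smul l := Subtype.ext (by
    change piR k H (l * 1) = l
    rw [mul_one, piR_of_mem])
  mul_smul g h l := Subtype.ext (by
    change piR k H (l * (h.unop * g.unop)) = piR k H (piR k H (l * h.unop) * g.unop)
    rw [piR_mul, mul_assoc])
  smul_zero h := Subtype.ext (by
    change piR k H (0 * h.unop) = 0
    simp)
  smul_add h x y := Subtype.ext (by
    change piR k H ((x + y) * h.unop) = piR k H (x * h.unop) + piR k H (y * h.unop)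
    rw [add_mul, map_add])
  add_smul g h x := Subtype.ext (by
    change piR k H (x * (g.unop + h.unop)) = piR k H (x * g.unop) + piR k H (x * h.unop)
    rw [mul_add, map_add])
  zero_smul x := Subtype.ext (by
    change piR k H (x * 0) = 0
    simp)

end Projections

end WeakHopf

/-- A weak Hopf algebra: a weak bialgebra with an antipode. -/
class WeakHopfAlgebra (k H : Type u) [Field k] [Ring H] [Algebra k H]
    extends WeakBialgebra k H where
  /-- The antipode `S`. -/
  antipode : H →ₗ[k] H
  /-- `h⁽¹⁾S(h⁽²⁾) = Π^L(h)` -/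
  mul_antipode : ∀ h : H,
    LinearMap.mul' k H (antipode.lTensor H (comul h)) = WeakHopf.piL k H h
  /-- `S(h⁽¹⁾)h⁽²⁾ = Π^R(h)` -/
  antipode_mul : ∀ h : H,
    LinearMap.mul' k H (antipode.rTensor H (comul h)) = WeakHopf.piR k H h
  /-- `S(h⁽¹⁾)h⁽²⁾S(h⁽³⁾) = S(h)` -/
  antipode_mul_antipode : ∀ h : H,
    LinearMap.mul' k H (TensorProduct.map antipode
      (LinearMap.mul' k H ∘ₗ antipode.lTensor H ∘ₗ comul) (comul h)) = antipode h

namespace WeakHopf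

/-! ### Tensor products over a noncommutative algebra -/

section BalTensor

variable (k : Type u) [Field k] (R : Type u) [Ring R]

/-- The subspace of `M ⊗[k] N` spanned by the elements `m·r ⊗ n - m ⊗ r·n`. -/
def balRel (M N : Type u) [AddCommGroup M] [Module k M] [Module Rᵐᵒᵖ M]
    [AddCommGroup N] [Module k N] [Module R N] : Submodule k (M ⊗[k] N) :=
  Submodule.span k {t | ∃ (m : M) (r : R) (n : N), t = (op r • m) ⊗ₜ[k] n - m ⊗ₜ[k] (r • n)}

/-- The tensor product `M ⊗_R N` of a right `R`-module `M` and a left `R`-module `N`, where `R` is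
a possibly noncommutative `k`-algebra. -/
def BalTensor (M N : Type u) [AddCommGroup M] [Module k M] [Module Rᵐᵒᵖ M]
    [AddCommGroup N] [Module k N] [Module R N] : Type u :=
  (M ⊗[k] N) ⧸ balRel k R M N

namespace BalTensor

variable (M N : Type u) [AddCommGroup M] [Module k M] [Module Rᵐᵒᵖ M]
    [AddCommGroup N] [Module k N] [Module R N]

noncomputable instance : AddCommGroup (BalTensor k R M N) :=
  inferInstanceAs (AddCommGroup ((M ⊗[k] N) ⧸ balRel k R M N))

noncomputable instance : Module k (BalTensor k R M N) :=
  inferInstanceAs (Module k ((M ⊗[k] N) ⧸ balRel k R M N))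

variable {M N}

/-- The pure tensor `m ⊗_R n`. -/
noncomputable def tmul (m : M) (n : N) : BalTensor k R M N :=
  Submodule.Quotient.mk (p := balRel k R M N) (m ⊗ₜ[k] n)

lemma smul_tmul (m : M) (r : R) (n : N) :
    tmul k R (op r • m) n = tmul k R m (r • n) :=
  (Submodule.Quotient.eq _).2 (Submodule.subset_span ⟨m, r, n, rfl⟩)

variable {k R}

@[elab_as_elim]
lemma induction_on {motive : BalTensor k R M N → Prop} (x : BalTensor k R M N)
    (zero : motive 0) (tmul : ∀ m n, motive (tmul k R m n))
    (add : ∀ x y, motive x → motive y → motive (x + y)) : motive x := by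
  obtain ⟨t, rfl⟩ := Submodule.Quotient.mk_surjective _ x
  induction t with
  | zero => exact zero
  | tmul m n => exact tmul m n
  | add x y hx hy => exact add _ _ hx hy

variable {M' N' : Type u} [AddCommGroup M'] [Module k M'] [Module Rᵐᵒᵖ M']
    [AddCommGroup N'] [Module k N'] [Module R N']

/-- The map `f ⊗_R g` induced by `k`-linear maps `f`, `g` that commute with the actions
of `R`. -/
noncomputable def map (f : M →ₗ[k] M') (g : N →ₗ[k] N')
    (hf : ∀ (r : R) (m : M), f (op r • m) = op r • f m)
    (hg : ∀ (r : R) (n : N), g (r • n) = r • g n) :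
    BalTensor k R M N →ₗ[k] BalTensor k R M' N' :=
  Submodule.mapQ (balRel k R M N) (balRel k R M' N') (TensorProduct.map f g) (by
    rw [balRel, Submodule.span_le]
    rintro _ ⟨m, r, n, rfl⟩
    refine Submodule.subset_span ⟨f m, r, g n, ?_⟩
    simp [hf, hg])

@[simp]
lemma map_tmul (f : M →ₗ[k] M') (g : N →ₗ[k] N')
    (hf : ∀ (r : R) (m : M), f (op r • m) = op r • f m)
    (hg : ∀ (r : R) (n : N), g (r • n) = r • g n) (m : M) (n : N) :
    map f g hf hg (tmul k R m n) = tmul k R (f m) (g n) := rfl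

lemma map_comm (f : M →ₗ[k] M) (g : N →ₗ[k] N')
    (hf : ∀ (r : R) (m : M), f (op r • m) = op r • f m)
    (hg : ∀ (r : R) (n : N), g (r • n) = r • g n) (x : BalTensor k R M N) :
    map LinearMap.id g (fun _ _ => rfl) hg (map f LinearMap.id hf (fun _ _ => rfl) x) =
      map f LinearMap.id hf (fun _ _ => rfl) (map LinearMap.id g (fun _ _ => rfl) hg x) := by
  induction x using induction_on with
  | zero => simp only [map_zero]
  | tmul m n => rfl
  | add x y hx hy => simp only [map_add, hx, hy]

lemma map_id (x : BalTensor k R M N) :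
    map LinearMap.id LinearMap.id (fun _ _ => rfl) (fun _ _ => rfl) x = x := by
  induction x using induction_on with
  | zero => rw [map_zero]
  | tmul m n => rfl
  | add x y hx hy => rw [map_add, hx, hy]

/-- The left action of `S` on `M ⊗_R N` for an `S`-`R`-bimodule `M`. -/
@[reducible]
noncomputable def leftModule (S : Type u) [Ring S] [Algebra k S] [Module S M]
    [IsScalarTower k S M] [SMulCommClass S Rᵐᵒᵖ M] : Module S (BalTensor k R M N) where
  smul s := map (Module.toModuleEnd k (S := S) M s) LinearMap.id
    (fun r m => smul_comm s (op r) m) (fun _ _ => rfl)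
  one_smul x := by
    induction x using induction_on with
    | zero => exact map_zero _
    | tmul m n => exact congrArg (tmul k R · n) (one_smul S m)
    | add x y hx hy => exact (map_add _ x y).trans (congrArg₂ (· + ·) hx hy)
  mul_smul s t x := by
    induction x using induction_on with
    | zero => rfl
    | tmul m n => exact congrArg (tmul k R · n) (mul_smul s t m)
    | add x y hx hy =>
      exact (map_add _ x y).trans ((congrArg₂ (· + ·) hx hy).trans (by
        refine Eq.symm ?_
        exact (congrArg _ (map_add _ x y)).trans (map_add _ _ _)))
  smul_zero s := map_zero _
  smul_add s x y := map_add _ x y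
  add_smul s t x := by
    induction x using induction_on with
    | zero => exact (map_zero _).trans (add_zero _).symm
    | tmul m n =>
      refine (congrArg (tmul k R · n) (add_smul s t m)).trans ?_
      exact congrArg (Submodule.Quotient.mk (p := balRel k R M N)) (TensorProduct.add_tmul _ _ _)
    | add x y hx hy =>
      refine (map_add _ x y).trans ((congrArg₂ (· + ·) hx hy).trans ?_)
      refine (add_add_add_comm _ _ _ _).trans (congrArg₂ (· + ·) ?_ ?_)
      · exact (map_add _ x y).symm
      · exact (map_add _ x y).symm
  zero_smul x := by
    induction x using induction_on with
    | zero => exact map_zero _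
    | tmul m n =>
      refine (congrArg (tmul k R · n) (zero_smul S m)).trans ?_
      exact congrArg (Submodule.Quotient.mk (p := balRel k R M N)) (TensorProduct.zero_tmul _ _)
    | add x y hx hy =>
      exact (map_add _ x y).trans ((congrArg₂ (· + ·) hx hy).trans (add_zero _))

end BalTensor

end BalTensor

/-! ### The spaces `H̄^{⊗ s} ⊗_{H^L} N` -/

section LeftModules

/-- Left `R`-modules over the `k`-algebra `R`, with their `k`-vector space structure. -/
structure LeftModule (k R : Type u) [Field k] [Ring R] [Algebra k R] where
  /-- The underlying type. -/
  carrier : Type u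
  [addCommGroup : AddCommGroup carrier]
  [moduleBase : Module k carrier]
  [module : Module R carrier]
  [isScalarTower : IsScalarTower k R carrier]

attribute [instance] LeftModule.addCommGroup LeftModule.moduleBase LeftModule.module
  LeftModule.isScalarTower

end LeftModules

section Bar

variable (k H : Type u) [Field k] [Ring H] [Algebra k H] [WeakBialgebra k H]

/-- `H^L` as a left `H^L`-submodule of `H`. -/
noncomputable def HLSubmodule : Submodule (HL k H) H where
  carrier := HL k H
  add_mem' hx hy := (HL k H).add_mem hx hy
  zero_mem' := (HL k H).zero_mem
  smul_mem' l _ hx := (HL k H).mul_mem l.2 hx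

/-- The quotient `H̄ = H / H^L`, as a left `H^L`-module. -/
abbrev Hbar : Type u := H ⧸ HLSubmodule k H

variable {H} in
/-- The class `h̄` of `h`. -/
noncomputable abbrev Hbar.mk (h : H) : Hbar k H := Submodule.Quotient.mk h

/-- Right multiplication by an element of `H^L`, as an endomorphism of the left `H^L`-module
`H̄`. -/
noncomputable def Hbar.mulRight (l : HL k H) : Hbar k H →ₗ[HL k H] Hbar k H :=
  Submodule.mapQ (HLSubmodule k H) (HLSubmodule k H)
    { toFun := fun h => h * l
      map_add' := fun x y => add_mul x y l
      map_smul' := fun r x => mul_assoc (r : H) x l }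
    (fun _ hx => (HL k H).mul_mem hx l.2)

/-- The right `H^L`-module structure `h̄ · l = \overline{hl}` of `H̄`. -/
noncomputable instance : Module (HL k H)ᵐᵒᵖ (Hbar k H) where
  smul l x := Hbar.mulRight k H l.unop x
  one_smul x := by
    obtain ⟨x, rfl⟩ := Submodule.Quotient.mk_surjective _ x
    exact congrArg (Hbar.mk k) (mul_one x)
  mul_smul l m x := by
    obtain ⟨x, rfl⟩ := Submodule.Quotient.mk_surjective _ x
    exact congrArg (Hbar.mk k) (mul_assoc x (m.unop : H) (l.unop : H)).symm
  smul_zero l := map_zero _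
  smul_add l x y := map_add _ x y
  add_smul l m x := by
    obtain ⟨x, rfl⟩ := Submodule.Quotient.mk_surjective _ x
    exact congrArg (Hbar.mk k) (mul_add x (l.unop : H) (m.unop : H))
  zero_smul x := by
    obtain ⟨x, rfl⟩ := Submodule.Quotient.mk_surjective _ x
    exact congrArg (Hbar.mk k) (mul_zero x)

instance : SMulCommClass (HL k H) (HL k H)ᵐᵒᵖ (Hbar k H) where
  smul_comm l m x := ((Hbar.mulRight k H m.unop).map_smul l x).symm

/-- The left `H^L`-module `H̄ ⊗_{H^L} (⋯ ⊗_{H^L} (H̄ ⊗_{H^L} N))` with `s` factors `H̄`; the left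
action is on the first factor. -/
noncomputable def barModule (N : LeftModule k (HL k H)) : ℕ → LeftModule k (HL k H)
  | 0 => N
  | s + 1 =>
    let T := barModule N s
    { carrier := BalTensor k (HL k H) (Hbar k H) T.carrier
      module := BalTensor.leftModule (HL k H)
      isScalarTower := by
        let _ : Module (HL k H) (BalTensor k (HL k H) (Hbar k H) T.carrier) :=
          BalTensor.leftModule (HL k H)
        refine ⟨fun c l x => ?_⟩
        induction x using BalTensor.induction_on with
        | zero => rw [smul_zero, smul_zero, smul_zero]
        | tmul m n =>
          exact congrArg (BalTensor.tmul k (HL k H) · n) (smul_assoc c l m)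
        | add x y hx hy => rw [smul_add, smul_add, smul_add, hx, hy] }

/-- The vector space `H̄^{⊗_{H^L} s} ⊗_{H^L} N` of a left `H^L`-module `N`. -/
noncomputable def Bar (s : ℕ) (N : Type u) [AddCommGroup N] [Module k N] [Module (HL k H) N]
    [IsScalarTower k (HL k H) N] : Type u :=
  (barModule k H ⟨N⟩ s).carrier

namespace Bar

section Basic

variable (s : ℕ) (N : Type u) [AddCommGroup N] [Module k N] [Module (HL k H) N]
    [IsScalarTower k (HL k H) N]

noncomputable instance : AddCommGroup (Bar k H s N) := (barModule k H ⟨N⟩ s).addCommGroup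

noncomputable instance : Module k (Bar k H s N) := (barModule k H ⟨N⟩ s).moduleBase

noncomputable instance : Module (HL k H) (Bar k H s N) := (barModule k H ⟨N⟩ s).module

instance : IsScalarTower k (HL k H) (Bar k H s N) := (barModule k H ⟨N⟩ s).isScalarTower

variable {H N}

/-- The pure tensor `h̄₁ ⊗ ⋯ ⊗ h̄ₛ ⊗ n`. -/
noncomputable def tmul : {s : ℕ} → (Fin s → H) → N → Bar k H s N
  | 0, _, n => n
  | _ + 1, h, n => BalTensor.tmul k (HL k H) (Hbar.mk k (h 0)) (tmul (Fin.tail h) n)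

variable {N' : Type u} [AddCommGroup N'] [Module k N'] [Module (HL k H) N']
    [IsScalarTower k (HL k H) N']

variable {k}

/-- The map `H̄^{⊗ s} ⊗_{H^L} f` induced by an `H^L`-linear map `f`. -/
noncomputable def map (f : N →ₗ[HL k H] N') : (s : ℕ) → (Bar k H s N →ₗ[HL k H] Bar k H s N')
  | 0 => f
  | s + 1 =>
    { toFun := BalTensor.map LinearMap.id ((map f s).restrictScalars k)
        (fun _ _ => rfl) (fun r x => (map f s).map_smul r x)
      map_add' := fun x y => LinearMap.map_add (BalTensor.map LinearMap.id
        ((map f s).restrictScalars k) (fun _ _ => rfl) (fun r x => (map f s).map_smul r x)) x y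
      map_smul' := fun _ x => BalTensor.map_comm _ _ _ _ x }

@[simp]
lemma map_tmul (f : N →ₗ[HL k H] N') (h : Fin s → H) (n : N) :
    map f s (tmul k h n) = tmul k h (f n) := by
  induction s with
  | zero => rfl
  | succ s ih => exact congrArg (BalTensor.tmul k (HL k H) (Hbar.mk k (h 0))) (ih _)

@[elab_as_elim]
lemma induction_on {motive : Bar k H s N → Prop} (x : Bar k H s N) (zero : motive 0)
    (tmul : ∀ h n, motive (tmul k h n)) (add : ∀ x y, motive x → motive y → motive (x + y)) :
    motive x := by
  induction s with
  | zero => exact tmul Fin.elim0 x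
  | succ s ih =>
    induction x using BalTensor.induction_on with
    | zero => exact zero
    | add x y hx hy => exact add x y hx hy
    | tmul m y =>
      obtain ⟨h, rfl⟩ := Submodule.Quotient.mk_surjective _ m
      have h0 (h : H) : BalTensor.tmul k (HL k H) (Hbar.mk k h) (0 : Bar k H s N) = 0 :=
        (congrArg (Submodule.Quotient.mk (p := balRel k (HL k H) (Hbar k H) (Bar k H s N)))
          (TensorProduct.tmul_zero _ _))
      have h1 (h : H) (x y : Bar k H s N) : BalTensor.tmul k (HL k H) (Hbar.mk k h) (x + y) =
          BalTensor.tmul k (HL k H) (Hbar.mk k h) x + BalTensor.tmul k (HL k H) (Hbar.mk k h) y :=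
        (congrArg (Submodule.Quotient.mk (p := balRel k (HL k H) (Hbar k H) (Bar k H s N)))
          (TensorProduct.tmul_add _ _ _))
      refine ih (motive := fun y => motive (BalTensor.tmul k (HL k H) (Hbar.mk k h) y)) y
        ?_ (fun g n => ?_) (fun x y hx hy => ?_)
      · exact Eq.mpr (congrArg motive (h0 h)) zero
      · have := tmul (Fin.cons h g) n
        rwa [Bar.tmul, Fin.tail_cons] at this
      · exact Eq.mpr (congrArg motive (h1 h x y)) (add _ _ hx hy)

lemma tmul_add (h : Fin s → H) (n n' : N) : tmul k h (n + n') = tmul k h n + tmul k h n' := by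
  induction s with
  | zero => rfl
  | succ s ih =>
    refine (congrArg (BalTensor.tmul k (HL k H) (Hbar.mk k (h 0))) (ih _)).trans ?_
    exact (congrArg (Submodule.Quotient.mk (p := balRel k (HL k H) (Hbar k H) (Bar k H s N)))
          (TensorProduct.tmul_add _ _ _))

lemma tmul_zero (h : Fin s → H) : tmul k h (0 : N) = 0 := by
  have := tmul_add (k := k) s h (0 : N) 0
  simpa using this

end Basic

section RightModule

variable (s : ℕ) (N : Type u) [AddCommGroup N] [Module k N] [Module (HL k H) N]
    [IsScalarTower k (HL k H) N] (A : Type u) [Ring A] [Module Aᵐᵒᵖ N]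
    [SMulCommClass Aᵐᵒᵖ (HL k H) N]

/-- The right action on the last factor: if `N` is an `H^L`-`A`-bimodule, then
`H̄^{⊗ s} ⊗_{H^L} N` is a right `A`-module. -/
noncomputable instance : Module Aᵐᵒᵖ (Bar k H s N) where
  smul a := map (Module.toModuleEnd (HL k H) (S := Aᵐᵒᵖ) N a) s
  one_smul x := by
    change map _ s x = x
    induction x using Bar.induction_on with
    | zero => rw [map_zero]
    | tmul h n => simp
    | add x y hx hy => rw [map_add, hx, hy]
  mul_smul a b x := by
    change map _ s x = map _ s (map _ s x)
    induction x using Bar.induction_on with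
    | zero => simp only [map_zero]
    | tmul h n => simp [mul_smul]
    | add x y hx hy => simp only [map_add, hx, hy]
  smul_zero a := map_zero _
  smul_add a x y := map_add _ x y
  add_smul a b x := by
    change map _ s x = map _ s x + map _ s x
    induction x using Bar.induction_on with
    | zero => simp only [map_zero, add_zero]
    | tmul h n => simp [add_smul, tmul_add]
    | add x y hx hy =>
      rw [LinearMap.map_add, LinearMap.map_add, LinearMap.map_add, hx, hy]; abel
  zero_smul x := by
    change map _ s x = 0
    induction x using Bar.induction_on with
    | zero => simp only [map_zero]
    | tmul h n => simp [tmul_zero]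
    | add x y hx hy => simp only [map_add, hx, hy, add_zero]

@[simp]
lemma op_smul_tmul (a : Aᵐᵒᵖ) (h : Fin s → H) (n : N) :
    a • tmul k h n = tmul k h (a • n) :=
  map_tmul s (Module.toModuleEnd (HL k H) (S := Aᵐᵒᵖ) N a) h n

end RightModule

end Bar

instance : SMulCommClass Hᵐᵒᵖ (HL k H) H where
  smul_comm a l x := (mul_assoc (l : H) x a.unop)

/-- `H^L ⊆ H` acts on the left of `H̄`; the vector space `H̄^{⊗_{H^L} (s+1)}` is
`H̄^{⊗_{H^L} s} ⊗_{H^L} H̄`. -/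
abbrev HbarPow (s : ℕ) : Type u := Bar k H s (Hbar k H)

instance : SMulCommClass (HL k H)ᵐᵒᵖ (HL k H) (Hbar k H) := SMulCommClass.symm _ _ _

variable {H} in
/-- The pure tensor `h̄₁ ⊗ ⋯ ⊗ h̄ₛ₊₁`. -/
noncomputable def HbarPow.tmul {s : ℕ} (h : Fin (s + 1) → H) : HbarPow k H s :=
  Bar.tmul k (Fin.init h) (Hbar.mk k (h (Fin.last s)))

/-! ### The differentials -/

section Chains

variable {k H}
variable {N : Type u} [AddCommGroup N] [Module k N] [Module H N] [IsScalarTower k H N]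

/-- The maps `d s : H̄^{⊗ (s+1)} ⊗_{H^L} N → H̄^{⊗ s} ⊗_{H^L} N` are the bar differentials:
`d(h̄₁ ⊗ n) = Π̄^R(h₁)·n - h₁·n`, and for `s ≥ 2`
`d(h̄₁ ⊗ ⋯ ⊗ h̄ₛ ⊗ n) = \overline{Π̄^R(h₁)h₂} ⊗ h̄₃ ⊗ ⋯ ⊗ h̄ₛ ⊗ n
  + ∑_{i=1}^{s-1} (-1)^i h̄₁ ⊗ ⋯ ⊗ \overline{hᵢhᵢ₊₁} ⊗ ⋯ ⊗ h̄ₛ ⊗ n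
  + (-1)^s h̄₁ ⊗ ⋯ ⊗ h̄ₛ₋₁ ⊗ hₛ·n`. Since pure tensors generate, these formulas determine `d`. -/
def IsBarDifferential (d : ∀ s : ℕ, Bar k H (s + 1) N → Bar k H s N) : Prop :=
  (∀ (h : Fin 1 → H) (n : N),
    d 0 (Bar.tmul k h n) = Bar.tmul k Fin.elim0 (piBarR k H (h 0) • n - h 0 • n)) ∧
  ∀ (s : ℕ) (h : Fin (s + 2) → H) (n : N),
    d (s + 1) (Bar.tmul k h n) =
      Bar.tmul k (Fin.contractNth 0 (fun a b => piBarR k H a * b) h) n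
      + ∑ i : Fin (s + 1), (-1 : ℤ) ^ ((i : ℕ) + 1) •
          Bar.tmul k (Fin.contractNth i.castSucc (fun a b => a * b) h) n
      + (-1 : ℤ) ^ (s + 2) • Bar.tmul k (Fin.init h) (h (Fin.last (s + 1)) • n)

variable (k H) in
/-- The augmentation `Π^R : H → H^R`. -/
noncomputable def augmentation : Bar k H 0 H →ₗ[Hᵐᵒᵖ] HR k H where
  toFun (h : H) := ⟨piR k H h, h, rfl⟩
  map_add' x y := Subtype.ext (map_add (piR k H) (x : H) (y : H))
  map_smul' a (x : H) := Subtype.ext (piR_mul (k := k) (x : H) a.unop).symm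

end Chains

section Cochains

variable {k H}
variable (N : Type u) [AddCommGroup N] [Module k N] [Module Hᵐᵒᵖ N] [IsScalarTower k Hᵐᵒᵖ N]

variable (k H) in
/-- `Hom_{H^L}(H̄^{⊗ (s+1)}, N)`: the maps that are linear over the right action of `H^L`. -/
def HomHL (s : ℕ) : Submodule k (HbarPow k H s →ₗ[k] N) where
  carrier := {b | ∀ (l : HL k H) (x : HbarPow k H s), b (op l • x) = op (l : H) • b x}
  add_mem' hb hc l x := by
    rw [LinearMap.add_apply, LinearMap.add_apply, hb, hc, smul_add]
  zero_mem' l x := by rw [LinearMap.zero_apply, LinearMap.zero_apply, smul_zero]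
  smul_mem' c b hb l x := by
    rw [LinearMap.smul_apply, LinearMap.smul_apply, hb, smul_comm]

variable (k H) in
/-- The spaces of cochains: `N` in degree `0` and `Hom_{H^L}(H̄^{⊗ s}, N)` in degree `s ≥ 1`. -/
def Cochain : ℕ → Type u
  | 0 => N
  | s + 1 => HomHL k H N s

namespace Cochain

noncomputable instance : (s : ℕ) → AddCommGroup (Cochain k H N s)
  | 0 => inferInstanceAs (AddCommGroup N)
  | s + 1 => inferInstanceAs (AddCommGroup (HomHL k H N s))

noncomputable instance : (s : ℕ) → Module k (Cochain k H N s)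
  | 0 => inferInstanceAs (Module k N)
  | s + 1 => inferInstanceAs (Module k (HomHL k H N s))

variable {N}

/-- The value `β(h̄₁ ⊗ ⋯ ⊗ h̄ₛ)` of a cochain of degree `s`. -/
noncomputable def eval : {s : ℕ} → Cochain k H N s → (Fin s → H) → N
  | 0, n, _ => n
  | s + 1, b, h => (show HomHL k H N s from b).1 (HbarPow.tmul k h)

end Cochain

variable {N}

/-- The maps `d s` from cochains of degree `s` to cochains of degree `s + 1` are the bar
differentials: `d(n)(h̄₁) = n·Π̄^R(h₁) - n·h₁`, and for `s ≥ 2`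
`d(β)(h̄₁ ⊗ ⋯ ⊗ h̄ₛ) = β(\overline{Π̄^R(h₁)h₂} ⊗ h̄₃ ⊗ ⋯ ⊗ h̄ₛ)
  + ∑_{i=1}^{s-1} (-1)^i β(h̄₁ ⊗ ⋯ ⊗ \overline{hᵢhᵢ₊₁} ⊗ ⋯ ⊗ h̄ₛ)
  + (-1)^s β(h̄₁ ⊗ ⋯ ⊗ h̄ₛ₋₁)·hₛ`. -/
def IsBarCodifferential (d : ∀ s : ℕ, Cochain k H N s → Cochain k H N (s + 1)) : Prop :=
  (∀ (n : Cochain k H N 0) (h : Fin 1 → H),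
    (d 0 n).eval h = op (piBarR k H (h 0)) • n.eval Fin.elim0 - op (h 0) • n.eval Fin.elim0) ∧
  ∀ (s : ℕ) (b : Cochain k H N (s + 1)) (h : Fin (s + 2) → H),
    (d (s + 1) b).eval h =
      b.eval (Fin.contractNth 0 (fun x y => piBarR k H x * y) h)
      + ∑ i : Fin (s + 1), (-1 : ℤ) ^ ((i : ℕ) + 1) •
          b.eval (Fin.contractNth i.castSucc (fun x y => x * y) h)
      + (-1 : ℤ) ^ (s + 2) • op (h (Fin.last (s + 1))) • b.eval (Fin.init h)

end Cochains

end Bar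

end WeakHopf

/-! ### Homology and cohomology -/

/- A module over the `k`-algebra `H` is a vector space over `k` by restriction of scalars. -/
open scoped ModuleCat

namespace WeakHopf

section TorExt

variable (k H : Type u) [Field k] [Ring H] [Algebra k H]

/-- The functor `- ⊗_H N` from right `H`-modules to vector spaces, for a left `H`-module `N`. -/
noncomputable def tensorFunctor (N : ModuleCat.{u} H) :
    ModuleCat.{u} Hᵐᵒᵖ ⥤ ModuleCat.{u} k where
  obj M := ModuleCat.of k (BalTensor k H M N)
  map f := ModuleCat.ofHom (BalTensor.map (f.hom.restrictScalars k) LinearMap.id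
    (fun r m => f.hom.map_smul (op r) m) (fun _ _ => rfl))
  map_id M := by
    ext x
    exact BalTensor.map_id x
  map_comp f g := by
    ext x
    induction x using BalTensor.induction_on with
    | zero => exact (map_zero _).trans (map_zero _).symm
    | tmul m n => rfl
    | add x y hx hy => rw [map_add, map_add, hx, hy]

instance (N : ModuleCat.{u} H) : (tensorFunctor k H N).Additive where
  map_add {M M' f g} := by
    ext x
    induction x using BalTensor.induction_on with
    | zero => exact (map_zero _).trans (map_zero _).symm
    | tmul m n =>
      exact congrArg (Submodule.Quotient.mk (p := balRel k H M' N)) (TensorProduct.add_tmul _ _ _)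
    | add x y hx hy =>
      exact (map_add _ x y).trans ((congrArg₂ (· + ·) hx hy).trans (map_add _ x y).symm)

variable {H} in
/-- The natural transformation `- ⊗_H f`. -/
noncomputable def tensorFunctorMap {N N' : ModuleCat.{u} H} (f : N ⟶ N') :
    tensorFunctor k H N ⟶ tensorFunctor k H N' where
  app M := ModuleCat.ofHom (BalTensor.map LinearMap.id (f.hom.restrictScalars k)
    (fun _ _ => rfl) (fun r n => f.hom.map_smul r n))
  naturality M M' g := by
    ext x
    induction x using BalTensor.induction_on with
    | zero => exact (map_zero _).trans (map_zero _).symm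
    | tmul m n => rfl
    | add x y hx hy =>
      exact (map_add _ x y).trans ((congrArg₂ (· + ·) hx hy).trans (map_add _ x y).symm)

variable [WeakBialgebra k H]

variable {k H} in
/-- The map `H̄^{⊗ s} ⊗_{H^L} f` for a map `f` of left `H`-modules. -/
noncomputable def Bar.mapHom {N N' : ModuleCat.{u} H} (f : N ⟶ N') (s : ℕ) :
    Bar k H s N →ₗ[k] Bar k H s N' :=
  (Bar.map (f.hom.restrictScalars (HL k H)) s).restrictScalars k

variable {k H} in
/-- The chain complex `N ← H̄ ⊗_{H^L} N ← H̄^{⊗ 2} ⊗_{H^L} N ← ⋯` with differentials `d`. -/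
noncomputable def barComplex {N : ModuleCat.{u} H}
    (d : ∀ s : ℕ, Bar k H (s + 1) N →ₗ[k] Bar k H s N) (hd : ∀ s, d s ∘ₗ d (s + 1) = 0) :
    ChainComplex (ModuleCat.{u} k) ℕ :=
  ChainComplex.of (fun s => ModuleCat.of k (Bar k H s N)) (fun s => ModuleCat.ofHom (d s))
    (fun s => congrArg ModuleCat.ofHom (hd s))

variable {k H} in
/-- The map of chain complexes with components `H̄^{⊗ s} ⊗_{H^L} f`. -/
noncomputable def barComplexMap {N N' : ModuleCat.{u} H} (f : N ⟶ N')
    {d : ∀ s : ℕ, Bar k H (s + 1) N →ₗ[k] Bar k H s N} (hd : ∀ s, d s ∘ₗ d (s + 1) = 0)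
    {d' : ∀ s : ℕ, Bar k H (s + 1) N' →ₗ[k] Bar k H s N'} (hd' : ∀ s, d' s ∘ₗ d' (s + 1) = 0)
    (hf : ∀ s, d' s ∘ₗ Bar.mapHom f (s + 1) = Bar.mapHom f s ∘ₗ d s) :
    barComplex d hd ⟶ barComplex d' hd' :=
  ChainComplex.ofHom (X := barComplex d hd) (Y := barComplex d' hd')
    (fun s => ModuleCat.ofHom (Bar.mapHom f s)) (fun s => by
      have h1 : (barComplex d hd).d (s + 1) s = ModuleCat.ofHom (d s) :=
        ChainComplex.of_d (fun s => ModuleCat.of k (Bar k H s N)) (fun s => ModuleCat.ofHom (d s)) s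
      have h2 : (barComplex d' hd').d (s + 1) s = ModuleCat.ofHom (d' s) :=
        ChainComplex.of_d (fun s => ModuleCat.of k (Bar k H s N'))
          (fun s => ModuleCat.ofHom (d' s)) s
      rw [h1, h2]
      exact congrArg ModuleCat.ofHom (hf s))

/-- The homology `H_n(H, N) = Tor_n^H(H^R, N)` with coefficients in a left `H`-module `N`: the
`n`-th left derived functor of `- ⊗_H N`, evaluated at `H^R`. -/
noncomputable def homology (N : ModuleCat.{u} H) (n : ℕ) : ModuleCat.{u} k :=
  ((tensorFunctor k H N).leftDerived n).obj (ModuleCat.of Hᵐᵒᵖ (HR k H))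

variable {H} in
/-- The map `H_n(H, N) → H_n(H, N')` induced by `f : N → N'`. -/
noncomputable def homologyMap {N N' : ModuleCat.{u} H} (f : N ⟶ N') (n : ℕ) :
    homology k H N n ⟶ homology k H N' n :=
  (NatTrans.leftDerived (tensorFunctorMap k f) n).app (ModuleCat.of Hᵐᵒᵖ (HR k H))

/-- The cohomology `H^n(H, N) = Ext^n_H(H^R, N)` with coefficients in a right `H`-module `N`. -/
abbrev cohomology (N : ModuleCat.{u} Hᵐᵒᵖ) (n : ℕ) : Type u :=
  Abelian.Ext.{u} (ModuleCat.of Hᵐᵒᵖ (HR k H)) N n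

variable {k H} in
/-- The map on cochains given by composition with a map of right `H`-modules. -/
noncomputable def Cochain.map {N N' : ModuleCat.{u} Hᵐᵒᵖ} (f : N ⟶ N') :
    (s : ℕ) → (Cochain k H N s →ₗ[k] Cochain k H N' s)
  | 0 => f.hom.restrictScalars k
  | s + 1 => ((LinearMap.llcomp k (HbarPow k H s) N N' (f.hom.restrictScalars k)).restrict
      (p := HomHL k H N s) (q := HomHL k H N' s) (fun b hb l x => by
        change f.hom (b _) = _ • f.hom (b x)
        rw [hb, map_smul]))

variable {k H} in
/-- The cochain complex `N → Hom_{H^L}(H̄, N) → Hom_{H^L}(H̄^{⊗ 2}, N) → ⋯` with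
differentials `d`. -/
noncomputable def cobarComplex {N : ModuleCat.{u} Hᵐᵒᵖ}
    (d : ∀ s : ℕ, Cochain k H N s →ₗ[k] Cochain k H N (s + 1))
    (hd : ∀ s, d (s + 1) ∘ₗ d s = 0) : CochainComplex (ModuleCat.{u} k) ℕ :=
  CochainComplex.of (fun s => ModuleCat.of k (Cochain k H N s)) (fun s => ModuleCat.ofHom (d s))
    (fun s => congrArg ModuleCat.ofHom (hd s))

variable {k H} in
/-- The map of cochain complexes given by composition with `f`. -/
noncomputable def cobarComplexMap {N N' : ModuleCat.{u} Hᵐᵒᵖ} (f : N ⟶ N')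
    {d : ∀ s : ℕ, Cochain k H N s →ₗ[k] Cochain k H N (s + 1)} (hd : ∀ s, d (s + 1) ∘ₗ d s = 0)
    {d' : ∀ s : ℕ, Cochain k H N' s →ₗ[k] Cochain k H N' (s + 1)}
    (hd' : ∀ s, d' (s + 1) ∘ₗ d' s = 0)
    (hf : ∀ s, d' s ∘ₗ Cochain.map f s = Cochain.map f (s + 1) ∘ₗ d s) :
    cobarComplex d hd ⟶ cobarComplex d' hd' :=
  CochainComplex.ofHom (X := cobarComplex d hd) (Y := cobarComplex d' hd')
    (fun s => ModuleCat.ofHom (Cochain.map f s)) (fun s => by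
      have h1 : (cobarComplex d hd).d s (s + 1) = ModuleCat.ofHom (d s) :=
        CochainComplex.of_d (fun s => ModuleCat.of k (Cochain k H N s))
          (fun s => ModuleCat.ofHom (d s)) s
      have h2 : (cobarComplex d' hd').d s (s + 1) = ModuleCat.ofHom (d' s) :=
        CochainComplex.of_d (fun s => ModuleCat.of k (Cochain k H N' s))
          (fun s => ModuleCat.ofHom (d' s)) s
      rw [h1, h2]
      exact congrArg ModuleCat.ofHom (hf s))

variable {k H} in
/-- The map `H^n(H, N) → H^n(H, N')` induced by `f : N → N'`. -/
noncomputable def cohomologyMap {N N' : ModuleCat.{u} Hᵐᵒᵖ} (f : N ⟶ N') (n : ℕ) :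
    cohomology k H N n →ₗ[k] cohomology k H N' n where
  toFun x := x.comp (Abelian.Ext.mk₀ f) (add_zero n)
  map_add' _ _ := Abelian.Ext.add_comp _ _ _ _
  map_smul' _ _ := Abelian.Ext.smul_comp _ _ _ _

end TorExt

end WeakHopf

/-! Everything is built from one construction. If `T` is a left `H`-module, then `g·(h̄ ⊗ t) =
\overline{gh} ⊗ t - ḡ ⊗ ht` makes `H̄ ⊗_{H^L} T` a left `H`-module whose restriction to `H^L` is the
obvious action on the first factor (`HAction.twist`). The map `h̄ ⊗ t ↦ Π̄^R(h)t - ht` leads back to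
`T` (`HAction.diff`). Iterating the twist equips every term of the bar complex with an `H`-action.
Expanding `h₁·(h̄₂ ⊗ ⋯ ⊗ n)` produces the alternating sum of contractions (`Bar.action_tmul`), so
these recursive maps are the stated differentials. Thus `d² = 0` becomes a single computation with
two elements of `H`, based on `Π̄^R(Π̄^R(g)h) = Π̄^R(gh)`, and compatibility of `d` with left
`H`-linear maps (`Bar.diff_map`) covers right multiplications, orbit maps and coefficient maps at
once.

Contraction: let `σ` turn the last entry `h ∈ H` into `h̄ ⊗ 1`, with sign. It commutes with `H^L` on
both sides but not with the twisted action, and the defect is exactly `h·σ(x) - σ(h·x) = h̄ ⊗ x`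
(`Bar.act_homotopy`). This identity is the homotopy formula. At the augmentation, the section is
`Π̄^R` restricted to `H^R`.

Projectivity: `H^L` is separable, with idempotent `Π^L(1⁽¹⁾) ⊗ 1⁽²⁾` (`mul'_sepElem`,
`lTensor_mulRight_sepElem`). Hence `V ⊗_{H^L} H` is a direct summand of a tensor product over `k`,
which is projective over `H` because `k` is a field. The antipode enters only here, through `Π^L(h)
= h⁽¹⁾S(h⁽²⁾)`.

Homology and cohomology are then computed with this resolution. Tensoring it with `N` cancels the
last factor `H` (`Bar.evalTensorEquiv`). Right `H`-linear maps out of it correspond to right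
`H^L`-linear maps on the powers of `H̄` (`Bar.extend`, `Bar.insertOne`), and `Ext` is read off as
cocycles modulo coboundaries. -/

namespace WeakHopf

/-! ### The projections of a weak Hopf algebra -/

section Projections

variable {k H : Type u} [Field k] [Ring H] [Algebra k H] [WeakBialgebra k H]

local notation "Δ" => (CoalgebraStruct.comul : H →ₗ[k] H ⊗[k] H)
local notation "ε" => (CoalgebraStruct.counit : H →ₗ[k] k)

/-- The projection sees `h` only through the functional `ε(h·-)`. Identities between compositions of
`Π^R` and `Π̄^R` therefore reduce to comparing functionals. -/
lemma piBarR_congr {h g : H} (hg : ∀ y, ε (h * y) = ε (g * y)) :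
    piBarR k H h = piBarR k H g := by
  have : ε ∘ₗ LinearMap.mulLeft k h = ε ∘ₗ LinearMap.mulLeft k g := LinearMap.ext hg
  change TensorProduct.lid k H ((ε ∘ₗ LinearMap.mulLeft k h).rTensor H (Δ 1)) = _
  rw [this]
  rfl

lemma piR_congr {h g : H} (hg : ∀ y, ε (h * y) = ε (g * y)) : piR k H h = piR k H g := by
  have : ε ∘ₗ LinearMap.mulLeft k h = ε ∘ₗ LinearMap.mulLeft k g := LinearMap.ext hg
  change TensorProduct.rid k H ((ε ∘ₗ LinearMap.mulLeft k h).lTensor H (Δ 1)) = _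
  rw [this]
  rfl

/-- This is the first weak counit axiom with middle argument `1`; `counit_piR_mul` comes from the
second in the same way. -/
lemma counit_piBarR_mul (h y : H) : ε (piBarR k H h * y) = ε (h * y) := by
  have := WeakBialgebra.counit_mul_left (k := k) h 1 y
  rw [mul_one] at this
  rw [this]
  simp only [piBarR, LinearMap.coe_mk, AddHom.coe_mk]
  generalize Δ 1 = t
  induction t with
  | zero => simp
  | add x y hx hy => simp only [map_add, add_mul, hx, hy]
  | tmul x y => simp

lemma counit_piR_mul (h y : H) : ε (piR k H h * y) = ε (h * y) := by
  have := WeakBialgebra.counit_mul_right (k := k) h 1 y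
  rw [mul_one] at this
  rw [this]
  simp only [piR, LinearMap.coe_mk, AddHom.coe_mk]
  generalize Δ 1 = t
  induction t with
  | zero => simp
  | add x y hx hy => simp only [map_add, add_mul, hx, hy]
  | tmul x y => simp [mul_comm]

lemma piBarR_mem (h : H) : piBarR k H h ∈ HL k H := ⟨_, piL_piBarR h⟩

lemma piBarR_of_mem {l : H} (hl : l ∈ HL k H) : piBarR k H l = l :=
  piBarR_of_comul (mem_range_piL.1 hl)

lemma piBarR_piBarR_mul (h g : H) : piBarR k H (piBarR k H h * g) = piBarR k H (h * g) :=
  piBarR_congr fun y => by rw [mul_assoc, counit_piBarR_mul, mul_assoc]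

/-- `Π̄^R(h)l` already lies in `H^L`, where `Π̄^R` is the identity. This makes the differential
balanced over `H^L` and the section of the augmentation right `H^L`-linear. -/
lemma piBarR_mul_of_mem (h : H) {l : H} (hl : l ∈ HL k H) :
    piBarR k H (h * l) = piBarR k H h * l := by
  rw [← piBarR_piBarR_mul, piBarR_of_mem ((HL k H).mul_mem (piBarR_mem h) hl)]

lemma piBarR_piR (h : H) : piBarR k H (piR k H h) = piBarR k H h :=
  piBarR_congr fun y => counit_piR_mul h y

lemma piR_piBarR (h : H) : piR k H (piBarR k H h) = piR k H h :=
  piR_congr fun y => counit_piBarR_mul h y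

end Projections

/-! ### Separability of `H^L` -/

section Separability

variable {k H : Type u} [Field k] [Ring H] [Algebra k H] [WeakHopfAlgebra k H]

local notation "Δ" => (CoalgebraStruct.comul : H →ₗ[k] H ⊗[k] H)
local notation "ε" => (CoalgebraStruct.counit : H →ₗ[k] k)

/-- Since `Δ(lg) = (l ⊗ 1)Δ(g)` for `l ∈ H^L`, the factor `l` can be pulled out of `Π^L(lg) =
(lg)⁽¹⁾S((lg)⁽²⁾)`. -/
lemma piL_mul_of_mem {l : H} (hl : l ∈ HL k H) (g : H) : piL k H (l * g) = l * piL k H g := by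
  have h1 : Δ l = (l ⊗ₜ[k] (1 : H)) * Δ 1 := mem_range_piL.1 hl
  have h2 : Δ (l * g) = (l ⊗ₜ[k] (1 : H)) * Δ g := by
    rw [WeakBialgebra.comul_mul, h1, mul_assoc, ← WeakBialgebra.comul_mul, one_mul]
  rw [← WeakHopfAlgebra.mul_antipode, ← WeakHopfAlgebra.mul_antipode, h2]
  generalize Δ g = t
  induction t with
  | zero => simp
  | add x y hx hy => simp only [map_add, mul_add, hx, hy]
  | tmul x y => simp [mul_assoc]

variable (k H) in
/-- The separability idempotent `Π^L(1⁽¹⁾) ⊗ 1⁽²⁾` of `H^L`. -/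
noncomputable def sepElem : HL k H ⊗[k] H :=
  LinearMap.rTensor H ((piL k H).codRestrict (Subalgebra.toSubmodule (HL k H))
    (fun h => ⟨h, rfl⟩)) (Δ 1)

lemma rTensor_val_sepElem :
    LinearMap.rTensor H (HL k H).val.toLinearMap (sepElem k H) =
      LinearMap.rTensor H (piL k H) (Δ 1) := by
  rw [sepElem]
  generalize Δ 1 = t
  induction t with
  | zero => simp
  | add x y hx hy => simp only [map_add, hx, hy]
  | tmul x y => rfl

lemma piL_eq_sum (r : Coalgebra.Repr k (1 : H) (H × H)) (h : H) :
    piL k H h = ∑ i ∈ r.index, ε (r.left i * h) • r.right i := by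
  simp [piL, ← r.eq]

lemma piBarR_eq_sum (r : Coalgebra.Repr k (1 : H) (H × H)) (h : H) :
    piBarR k H h = ∑ i ∈ r.index, ε (h * r.left i) • r.right i := by
  simp [piBarR, ← r.eq]

/-- Written out, the product is `ε(1⁽¹'⁾1⁽¹⁾)1⁽²'⁾1⁽²⁾ = (ε ⊗ id)(Δ(1)Δ(1))`, and `Δ(1)` is
idempotent. -/
lemma mul'_sepElem :
    LinearMap.mul' k H (LinearMap.rTensor H (HL k H).val.toLinearMap (sepElem k H)) = 1 := by
  let r := Coalgebra.Repr.arbitrary k (1 : H)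
  have h1 := congrArg (TensorProduct.lid k H) (Coalgebra.rTensor_counit_comul (R := k) (1 : H))
  rw [TensorProduct.lid_tmul, one_smul] at h1
  rw [rTensor_val_sepElem]
  refine Eq.trans ?_ h1
  have h2 : Δ 1 = Δ 1 * Δ 1 := by rw [← WeakBialgebra.comul_mul, one_mul]
  conv_rhs => rw [h2]
  rw [← r.eq, Finset.sum_mul_sum, Finset.sum_comm]
  simp [piL_eq_sum r, Finset.sum_mul]

/-- Centrality of the separability element. With a second copy of `Δ(1)` for `Π^L`, both sides take
the form `1⁽²'⁾ ⊗ -`, with second leg `Π̄^R(1⁽¹'⁾)l` on the left and `Π̄^R(1⁽¹'⁾l)` on the right. -/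
lemma lTensor_mulRight_sepElem (l : HL k H) :
    LinearMap.lTensor (HL k H) (LinearMap.mulRight k (l : H)) (sepElem k H) =
      LinearMap.rTensor H (LinearMap.mulLeft k l) (sepElem k H) := by
  -- Over a field `H^L ⊗ H` embeds in `H ⊗ H`, where the first leg may be expanded by the formula
  -- for `Π^L`.
  apply Module.Flat.rTensor_preserves_injective_linearMap (M := H) (HL k H).val.toLinearMap
    Subtype.val_injective
  have h1 : LinearMap.rTensor H (HL k H).val.toLinearMap
      (LinearMap.rTensor H (LinearMap.mulLeft k l) (sepElem k H)) =
      LinearMap.rTensor H (LinearMap.mulLeft k (l : H))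
        (LinearMap.rTensor H (HL k H).val.toLinearMap (sepElem k H)) := by
    rw [← LinearMap.rTensor_comp_apply, ← LinearMap.rTensor_comp_apply]
    rfl
  have h2 : LinearMap.rTensor H (HL k H).val.toLinearMap
      (LinearMap.lTensor (HL k H) (LinearMap.mulRight k (l : H)) (sepElem k H)) =
      LinearMap.lTensor H (LinearMap.mulRight k (l : H))
        (LinearMap.rTensor H (HL k H).val.toLinearMap (sepElem k H)) := by
    rw [← LinearMap.comp_apply, ← LinearMap.comp_apply, LinearMap.rTensor_comp_lTensor,
      LinearMap.lTensor_comp_rTensor]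
  rw [h1, h2, rTensor_val_sepElem]
  let r := Coalgebra.Repr.arbitrary k (1 : H)
  rw [← r.eq]
  simp only [map_sum, LinearMap.rTensor_tmul, LinearMap.lTensor_tmul, LinearMap.mulRight_apply,
    LinearMap.mulLeft_apply, ← piL_mul_of_mem l.2]
  simp only [piL_eq_sum r, TensorProduct.sum_tmul]
  -- The outer sum now runs over the copy of `Δ(1)` introduced by `Π^L`; the inner sum over the
  -- original copy assembles into `Π̄^R`.
  rw [Finset.sum_comm, Finset.sum_comm (s := r.index) (t := r.index)
    (f := fun x y => (ε (r.left y * (l * r.left x)) • r.right y) ⊗ₜ[k] r.right x)]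
  refine Finset.sum_congr rfl fun i _ => ?_
  have h3 := congrArg (r.right i ⊗ₜ[k] ·) (piBarR_mul_of_mem (k := k) (r.left i) l.2)
  simp only [piBarR_eq_sum r, Finset.sum_mul, TensorProduct.tmul_sum] at h3
  simpa [TensorProduct.smul_tmul', mul_assoc] using h3.symm

end Separability

end WeakHopf

namespace WeakHopf

/-! ### Linear maps out of balanced tensor products -/

namespace BalTensor

variable {k : Type u} [Field k] {R : Type u} [Ring R]
variable {M N P : Type u} [AddCommGroup M] [Module k M] [Module Rᵐᵒᵖ M]
  [AddCommGroup N] [Module k N] [Module R N] [AddCommGroup P] [Module k P]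

variable (k R M N) in
/-- The pure tensor `m ⊗_R n`, as a bilinear map. -/
noncomputable def mk : M →ₗ[k] N →ₗ[k] BalTensor k R M N :=
  (TensorProduct.mk k M N).compr₂ (balRel k R M N).mkQ

lemma tmul_add (m : M) (n n' : N) : tmul k R m (n + n') = tmul k R m n + tmul k R m n' :=
  (mk k R M N m).map_add n n'

lemma tmul_zero (m : M) : tmul k R m (0 : N) = 0 := (mk k R M N m).map_zero

lemma add_tmul (m m' : M) (n : N) : tmul k R (m + m') n = tmul k R m n + tmul k R m' n :=
  ((mk k R M N).flip n).map_add m m'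

lemma zero_tmul (n : N) : tmul k R (0 : M) n = 0 := ((mk k R M N).flip n).map_zero

lemma smul_tmul' (c : k) (m : M) (n : N) : tmul k R (c • m) n = c • tmul k R m n :=
  ((mk k R M N).flip n).map_smul c m

/-- The linear map out of `M ⊗_R N` induced by a balanced bilinear map. -/
noncomputable def lift (f : M →ₗ[k] N →ₗ[k] P)
    (hf : ∀ (m : M) (r : R) (n : N), f (op r • m) n = f m (r • n)) :
    BalTensor k R M N →ₗ[k] P :=
  (balRel k R M N).liftQ (TensorProduct.lift f) (by
    rw [balRel, Submodule.span_le]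
    rintro _ ⟨m, r, n, rfl⟩
    simp [hf])

lemma hom_ext {f g : BalTensor k R M N →ₗ[k] P}
    (h : ∀ m n, f (tmul k R m n) = g (tmul k R m n)) : f = g := by
  ext x
  induction x using induction_on with
  | zero => rw [map_zero, map_zero]
  | tmul m n => exact h m n
  | add x y hx hy => rw [map_add, map_add, hx, hy]

end BalTensor

/-! ### The left `H`-module `H̄ ⊗_{H^L} T` -/

section Twist

variable {k H : Type u} [Field k] [Ring H] [Algebra k H] [WeakBialgebra k H]

/-- The left action of `H^L` on the first factor of `H̄ ⊗_{H^L} T`. -/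
noncomputable local instance {T : Type u} [AddCommGroup T] [Module k T] [Module (HL k H) T] :
    Module (HL k H) (BalTensor k (HL k H) (Hbar k H) T) := BalTensor.leftModule (HL k H)

section Hbar

variable {P : Type u} [AddCommGroup P] [Module k P]

variable (k H) in
/-- The quotient map `H → H̄`. -/
noncomputable def Hbar.mkₗ : H →ₗ[k] Hbar k H := (HLSubmodule k H).mkQ.restrictScalars k

lemma Hbar.mk_of_mem {l : H} (hl : l ∈ HL k H) : Hbar.mk k l = 0 :=
  (Submodule.Quotient.mk_eq_zero (HLSubmodule k H)).2 hl

/-- The linear map out of `H̄` induced by a linear map on `H` that vanishes on `H^L`. -/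
noncomputable def Hbar.lift (f : H →ₗ[k] P) (hf : ∀ l ∈ HL k H, f l = 0) : Hbar k H →ₗ[k] P :=
  ((HLSubmodule k H).restrictScalars k).liftQ f (fun l hl => hf l hl) ∘ₗ
    (Submodule.Quotient.restrictScalarsEquiv k (HLSubmodule k H)).symm.toLinearMap

end Hbar

variable {T : Type u} [AddCommGroup T] [Module k T] [Module (HL k H) T]
variable {T' : Type u} [AddCommGroup T'] [Module k T'] [Module (HL k H) T']

@[elab_as_elim]
lemma hbarTensor_induction {motive : BalTensor k (HL k H) (Hbar k H) T → Prop}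
    (x : BalTensor k (HL k H) (Hbar k H) T) (zero : motive 0)
    (tmul : ∀ (h : H) (t : T), motive (BalTensor.tmul k (HL k H) (Hbar.mk k h) t))
    (add : ∀ x y, motive x → motive y → motive (x + y)) : motive x := by
  induction x using BalTensor.induction_on with
  | zero => exact zero
  | tmul m n =>
    obtain ⟨h, rfl⟩ := Submodule.Quotient.mk_surjective _ m
    exact tmul h n
  | add x y hx hy => exact add x y hx hy

/-- The linear map out of `H̄ ⊗_{H^L} T` induced by a balanced bilinear map on `H × T` that vanishes
on `H^L × T`. -/
noncomputable def hbarTensorLift {P : Type u} [AddCommGroup P] [Module k P]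
    (f : H →ₗ[k] T →ₗ[k] P) (h0 : ∀ l ∈ HL k H, f l = 0)
    (hf : ∀ (h : H) (l : HL k H) (t : T), f (h * l) t = f h (l • t)) :
    BalTensor k (HL k H) (Hbar k H) T →ₗ[k] P :=
  BalTensor.lift (Hbar.lift f h0) (fun m l t => by
    obtain ⟨h, rfl⟩ := Submodule.Quotient.mk_surjective _ m
    exact hf h l t)

lemma tmul_mul_coe (h : H) (l : HL k H) (t : T) :
    BalTensor.tmul k (HL k H) (Hbar.mk k (h * l)) t =
      BalTensor.tmul k (HL k H) (Hbar.mk k h) (l • t) :=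
  BalTensor.smul_tmul k (HL k H) (Hbar.mk k h) l t

variable (k H T) in
/-- A left action of `H` on a left `H^L`-module `T` that extends the action of `H^L`. -/
structure HAction where
  /-- The action. -/
  act : H →ₗ[k] T →ₗ[k] T
  act_mul : ∀ g h t, act (g * h) t = act g (act h t)
  act_coe : ∀ (l : HL k H) t, act l t = l • t

namespace HAction

variable (a : HAction k H T) (a' : HAction k H T')

/-- The restriction of a left `H`-module. -/
noncomputable def ofModule (N : Type u) [AddCommGroup N] [Module k N] [Module H N]
    [IsScalarTower k H N] : HAction k H N where
  act := (Algebra.lsmul k k N).toLinearMap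
  act_mul g h t := mul_smul g h t
  act_coe _ _ := rfl

/-- The action `g · (h̄ ⊗ t) = \overline{gh} ⊗ t - ḡ ⊗ ht`, for a fixed `g`. -/
noncomputable def twistAct (g : H) :
    BalTensor k (HL k H) (Hbar k H) T →ₗ[k] BalTensor k (HL k H) (Hbar k H) T :=
  hbarTensorLift
    ((BalTensor.mk k (HL k H) (Hbar k H) T ∘ₗ Hbar.mkₗ k H) ∘ₗ LinearMap.mulLeft k g -
      (LinearMap.llcomp k T T _ (BalTensor.mk k (HL k H) (Hbar k H) T (Hbar.mk k g))) ∘ₗ a.act)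
    (fun l hl => by
      ext t
      change BalTensor.tmul k (HL k H) (Hbar.mk k (g * l)) t -
        BalTensor.tmul k (HL k H) (Hbar.mk k g) (a.act l t) = 0
      -- Left multiplication by `g` does not preserve `H^L`; the correction term is what makes the
      -- map vanish on `H^L`, as `\overline{gl} ⊗ t = ḡ ⊗ lt`.
      rw [a.act_coe ⟨l, hl⟩, ← tmul_mul_coe, sub_self])
    (fun h l t => by
      change BalTensor.tmul k (HL k H) (Hbar.mk k (g * (h * l))) t -
        BalTensor.tmul k (HL k H) (Hbar.mk k g) (a.act (h * l) t) =
        BalTensor.tmul k (HL k H) (Hbar.mk k (g * h)) (l • t) -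
        BalTensor.tmul k (HL k H) (Hbar.mk k g) (a.act h (l • t))
      rw [a.act_mul, a.act_coe, ← mul_assoc, tmul_mul_coe])

lemma twistAct_tmul (g h : H) (t : T) :
    a.twistAct g (BalTensor.tmul k (HL k H) (Hbar.mk k h) t) =
      BalTensor.tmul k (HL k H) (Hbar.mk k (g * h)) t -
        BalTensor.tmul k (HL k H) (Hbar.mk k g) (a.act h t) := rfl

/-- The left `H`-module `H̄ ⊗_{H^L} T` with `g · (h̄ ⊗ t) = \overline{gh} ⊗ t - ḡ ⊗ ht`. -/
noncomputable def twist : HAction k H (BalTensor k (HL k H) (Hbar k H) T) where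
  act :=
    { toFun := a.twistAct
      map_add' := fun g g' => by
        ext x
        induction x using hbarTensor_induction with
        | zero => simp only [map_zero]
        | tmul h t =>
          rw [LinearMap.add_apply]
          simp only [twistAct_tmul, add_mul, Submodule.Quotient.mk_add, BalTensor.add_tmul]
          abel
        | add x y hx hy => rw [map_add, map_add, hx, hy]
      map_smul' := fun c g => by
        ext x
        induction x using hbarTensor_induction with
        | zero => simp only [map_zero]
        | tmul h t =>
          rw [RingHom.id_apply, LinearMap.smul_apply]
          simp only [twistAct_tmul, smul_mul_assoc, Submodule.Quotient.mk_smul,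
            BalTensor.smul_tmul', smul_sub]
        | add x y hx hy => rw [map_add, map_add, hx, hy] }
  act_mul g h x := by
    change a.twistAct (g * h) x = a.twistAct g (a.twistAct h x)
    induction x using hbarTensor_induction with
    | zero => simp only [map_zero]
    | tmul h' t =>
      simp only [twistAct_tmul, map_sub, a.act_mul, mul_assoc]
      abel
    | add x y hx hy => simp only [map_add, hx, hy]
  act_coe l x := by
    change a.twistAct l x = l • x
    induction x using hbarTensor_induction with
    | zero => rw [map_zero, smul_zero]
    | tmul h' t =>
      -- For `l ∈ H^L` the correction term is `l̄ ⊗ ht = 0`.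
      rw [twistAct_tmul, Hbar.mk_of_mem l.2, BalTensor.zero_tmul, sub_zero]
      rfl
    | add x y hx hy => rw [map_add, smul_add, hx, hy]

lemma twist_act_tmul (g h : H) (t : T) :
    a.twist.act g (BalTensor.tmul k (HL k H) (Hbar.mk k h) t) =
      BalTensor.tmul k (HL k H) (Hbar.mk k (g * h)) t -
        BalTensor.tmul k (HL k H) (Hbar.mk k g) (a.act h t) := rfl

/-- The differential `h̄ ⊗ t ↦ Π̄^R(h)t - ht`. -/
noncomputable def diff : BalTensor k (HL k H) (Hbar k H) T →ₗ[k] T :=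
  hbarTensorLift (a.act ∘ₗ piBarR k H - a.act)
    (fun l hl => by
      ext t
      change a.act (piBarR k H l) t - a.act l t = 0
      rw [piBarR_of_mem hl, sub_self])
    (fun h l t => by
      change a.act (piBarR k H (h * l)) t - a.act (h * l) t =
        a.act (piBarR k H h) (l • t) - a.act h (l • t)
      rw [piBarR_mul_of_mem h l.2, a.act_mul, a.act_mul, a.act_coe])

lemma diff_tmul (h : H) (t : T) :
    a.diff (BalTensor.tmul k (HL k H) (Hbar.mk k h) t) = a.act (piBarR k H h) t - a.act h t := rfl

/-- On `ḡ ⊗ h̄ ⊗ t` the terms `Π̄^R(g)ht` and `ght` each occur with both signs. The remaining terms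
`Π̄^R(Π̄^R(g)h)t` and `Π̄^R(gh)t` cancel because the two projections agree. -/
lemma diff_diff (x) : a.diff (a.twist.diff x) = 0 := by
  induction x using hbarTensor_induction with
  | zero => simp only [map_zero]
  | add x y hx hy => simp only [map_add, hx, hy, add_zero]
  | tmul g x =>
    induction x using hbarTensor_induction with
    | zero => simp only [BalTensor.tmul_zero, map_zero]
    | add x y hx hy => simp only [BalTensor.tmul_add, map_add, hx, hy, add_zero]
    | tmul h t =>
      rw [diff_tmul, twist_act_tmul, twist_act_tmul, Hbar.mk_of_mem (piBarR_mem g),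
        BalTensor.zero_tmul, sub_zero]
      simp only [map_sub, diff_tmul, piBarR_piBarR_mul, a.act_mul]
      abel

variable [IsScalarTower k (HL k H) T] [IsScalarTower k (HL k H) T']

/-- The map `H̄ ⊗_{H^L} φ`. -/
noncomputable def whisker (φ : T →ₗ[HL k H] T') :
    BalTensor k (HL k H) (Hbar k H) T →ₗ[HL k H] BalTensor k (HL k H) (Hbar k H) T' where
  toFun := BalTensor.map LinearMap.id (φ.restrictScalars k) (fun _ _ => rfl)
    (fun r x => φ.map_smul r x)
  map_add' x y := map_add _ x y
  map_smul' _ x := BalTensor.map_comm _ _ _ _ x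

lemma whisker_tmul (φ : T →ₗ[HL k H] T') (m : Hbar k H) (t : T) :
    whisker φ (BalTensor.tmul k (HL k H) m t) = BalTensor.tmul k (HL k H) m (φ t) := rfl

variable {a a'}

/-- The twist is functorial in `H`-equivariant maps, so equivariance passes up the iteration. -/
lemma whisker_act {φ : T →ₗ[HL k H] T'} (hφ : ∀ h t, φ (a.act h t) = a'.act h (φ t)) (h : H) (x) :
    whisker φ (a.twist.act h x) = a'.twist.act h (whisker φ x) := by
  induction x using hbarTensor_induction with
  | zero => simp only [map_zero]
  | add x y hx hy => simp only [map_add, hx, hy]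
  | tmul g t => simp only [twist_act_tmul, map_sub, whisker_tmul, hφ]

lemma diff_whisker {φ : T →ₗ[HL k H] T'} (hφ : ∀ h t, φ (a.act h t) = a'.act h (φ t)) (x) :
    a'.diff (whisker φ x) = φ (a.diff x) := by
  induction x using hbarTensor_induction with
  | zero => simp only [map_zero]
  | add x y hx hy => simp only [map_add, hx, hy]
  | tmul g t => simp only [diff_tmul, map_sub, whisker_tmul, hφ]

end HAction

end Twist

end WeakHopf

/-! ### The bar complex as an iterated twist, and its explicit formula -/

namespace WeakHopf

/-- This and the next two lemmas split off the first entry, the variable on which the recursive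
definition of the bar terms operates. -/
lemma contractNth_zero_cons {α : Type*} {s : ℕ} (f : α → α → α) (g : α) (h : Fin (s + 1) → α) :
    Fin.contractNth 0 f (Fin.cons g h : Fin (s + 2) → α) =
      Fin.cons (f g (h 0)) (Fin.tail h) := by
  funext j
  refine Fin.cases ?_ (fun j => ?_) j
  · simp [Fin.contractNth]
  · simp [Fin.contractNth, Fin.tail]

lemma contractNth_succ_cons {α : Type*} {s : ℕ} (i : Fin (s + 1)) (f : α → α → α) (g : α)
    (h : Fin (s + 1) → α) :
    Fin.contractNth i.succ f (Fin.cons g h : Fin (s + 2) → α) =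
      Fin.cons g (Fin.contractNth i f h) := by
  funext j
  refine Fin.cases ?_ (fun j => ?_) j
  · simp [Fin.contractNth]
  · simp [Fin.contractNth]

lemma init_cons {α : Type*} {s : ℕ} (g : α) (h : Fin (s + 1) → α) :
    Fin.init (Fin.cons g h : Fin (s + 2) → α) = (Fin.cons g (Fin.init h) : Fin (s + 1) → α) := by
  funext j
  refine Fin.cases ?_ (fun j => ?_) j
  · rfl
  · rfl

namespace Bar

variable {k H : Type u} [Field k] [Ring H] [Algebra k H] [WeakBialgebra k H]

section Cons

variable {N : Type u} [AddCommGroup N] [Module k N] [Module (HL k H) N]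
  [IsScalarTower k (HL k H) N] {s : ℕ}

/-- The tensor `h̄ ⊗ x` for `x ∈ H̄^{⊗ s} ⊗_{H^L} N`. -/
noncomputable def cons (h : H) (x : Bar k H s N) : Bar k H (s + 1) N :=
  BalTensor.tmul k (HL k H) (Hbar.mk k h) x

lemma tmul_succ (h : Fin (s + 1) → H) (n : N) : tmul k h n = cons (h 0) (tmul k (Fin.tail h) n) :=
  rfl

lemma tmul_cons (g : H) (h : Fin s → H) (n : N) :
    tmul k (Fin.cons g h : Fin (s + 1) → H) n = cons g (tmul k h n) := by
  rw [tmul_succ, Fin.tail_cons, Fin.cons_zero]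

variable (k N s) in
/-- The map `x ↦ h̄ ⊗ x`. -/
noncomputable def consₗ (h : H) : Bar k H s N →ₗ[k] Bar k H (s + 1) N :=
  BalTensor.mk k (HL k H) (Hbar k H) (Bar k H s N) (Hbar.mk k h)

lemma consₗ_apply (h : H) (x : Bar k H s N) : consₗ k N s h x = cons h x := rfl

lemma cons_add (h : H) (x y : Bar k H s N) : cons h (x + y) = cons h x + cons h y :=
  (consₗ k N s h).map_add x y

lemma cons_sub (h : H) (x y : Bar k H s N) : cons h (x - y) = cons h x - cons h y :=
  (consₗ k N s h).map_sub x y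

lemma cons_zero (h : H) : cons h (0 : Bar k H s N) = 0 := (consₗ k N s h).map_zero

lemma cons_smul (h : H) (c : k) (x : Bar k H s N) : cons h (c • x) = c • cons h x :=
  (consₗ k N s h).map_smul c x

lemma add_cons (g h : H) (x : Bar k H s N) : cons (g + h) x = cons g x + cons h x :=
  BalTensor.add_tmul (k := k) (R := HL k H) (Hbar.mk k g) (Hbar.mk k h) x

lemma mul_coe_cons (h : H) (l : HL k H) (x : Bar k H s N) :
    cons (h * l) x = cons h (l • x) := tmul_mul_coe h l x

lemma smul_cons (l : HL k H) (h : H) (x : Bar k H s N) : l • cons h x = cons (l * h) x := rfl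

lemma cons_of_mem {h : H} (hh : h ∈ HL k H) (x : Bar k H s N) : cons h x = 0 := by
  rw [cons, Hbar.mk_of_mem hh]
  exact BalTensor.zero_tmul (k := k) (R := HL k H) x

@[elab_as_elim]
lemma cons_induction {motive : Bar k H (s + 1) N → Prop} (x : Bar k H (s + 1) N)
    (zero : motive 0) (cons : ∀ h x, motive (cons h x))
    (add : ∀ x y, motive x → motive y → motive (x + y)) : motive x :=
  hbarTensor_induction x zero cons add

/-- The linear map on `H̄ ⊗_{H^L} (H̄^{⊗ s} ⊗_{H^L} N)` induced by a balanced bilinear map. -/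
noncomputable def consLift {P : Type u} [AddCommGroup P] [Module k P]
    (f : H →ₗ[k] Bar k H s N →ₗ[k] P) (h0 : ∀ l ∈ HL k H, f l = 0)
    (hf : ∀ (h : H) (l : HL k H) (x : Bar k H s N), f (h * l) x = f h (l • x)) :
    Bar k H (s + 1) N →ₗ[k] P :=
  hbarTensorLift f h0 hf

variable {N' : Type u} [AddCommGroup N'] [Module k N'] [Module (HL k H) N']
  [IsScalarTower k (HL k H) N']

lemma op_smul_cons {A : Type u} [Ring A] [Module Aᵐᵒᵖ N] [SMulCommClass Aᵐᵒᵖ (HL k H) N]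
    (a : Aᵐᵒᵖ) (h : H) (x : Bar k H s N) : a • cons h x = cons h (a • x) := rfl

end Cons

section Action

variable (N : Type u) [AddCommGroup N] [Module k N] [Module H N] [IsScalarTower k H N]

/-- The left action of `H` on `H̄^{⊗ s} ⊗_{H^L} N` obtained by iterating `HAction.twist`. -/
noncomputable def action : (s : ℕ) → HAction k H (Bar k H s N)
  | 0 => (HAction.ofModule N : HAction k H N)
  | s + 1 => (action s).twist

/-- The bar differential. -/
noncomputable def diff (s : ℕ) : Bar k H (s + 1) N →ₗ[k] Bar k H s N := (action N s).diff

variable {N} {s : ℕ}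

lemma action_cons (g h : H) (x : Bar k H s N) :
    (action N (s + 1)).act g (cons h x) = cons (g * h) x - cons g ((action N s).act h x) := rfl

lemma diff_cons (h : H) (x : Bar k H s N) :
    diff N s (cons h x) = (action N s).act (piBarR k H h) x - (action N s).act h x := rfl

lemma diff_diff (s : ℕ) (x : Bar k H (s + 2) N) : diff N s (diff N (s + 1) x) = 0 :=
  (action N s).diff_diff x

/-- Each twist contributes one contraction of the first two entries and moves the remaining action
one place to the right with a change of sign; after `s` twists it reaches `N`. -/
lemma action_tmul (s : ℕ) (h : Fin (s + 1) → H) (n : N) :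
    (action N s).act (h 0) (tmul k (Fin.tail h) n) =
      ∑ i : Fin s, (-1 : ℤ) ^ (i : ℕ) •
          tmul k (Fin.contractNth i.castSucc (fun a b => a * b) h) n
      + (-1 : ℤ) ^ s • tmul k (Fin.init h) (h (Fin.last s) • n) := by
  induction s with
  | zero =>
    have h1 : (action N 0).act (h 0) (tmul k (Fin.tail h) n) =
      tmul k (Fin.init h) (h (Fin.last 0) • n) := rfl
    simp [h1]
  | succ s ih =>
    induction h using Fin.consCases with
    | _ g h =>
    -- The summand `i = 0` is the term in which `g` multiplies the next entry; the others come from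
    -- the induction hypothesis under `-ḡ ⊗ -`, which shifts the index and the sign.
    rw [Fin.cons_zero, Fin.tail_cons, tmul_succ, action_cons, ih, ← consₗ_apply (h := g), map_add,
      map_sum, Fin.sum_univ_succ]
    simp only [map_zsmul, consₗ_apply, ← tmul_cons, Fin.castSucc_zero, contractNth_zero_cons,
      Fin.castSucc_succ, contractNth_succ_cons, init_cons, Fin.val_zero, pow_zero, one_smul,
      Fin.val_succ, pow_succ, mul_neg, mul_one, neg_smul, Finset.sum_neg_distrib]
    rw [← Fin.succ_last, Fin.cons_succ]
    abel

variable (N) in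
lemma isBarDifferential : IsBarDifferential (k := k) (H := H) (N := N) (fun s => diff N s) := by
  refine ⟨fun h n => ?_, fun s h n => ?_⟩
  · exact (diff_cons (h 0) (tmul k (Fin.tail h) n)).trans rfl
  -- As `Π̄^R(h₁)` lies in `H^L`, its twisted action is multiplication on the first factor alone,
  -- which gives the special first summand.
  have h2 : (action N (s + 1)).act (piBarR k H (h 0)) (tmul k (Fin.tail h) n) =
      tmul k (Fin.contractNth 0 (fun a b => piBarR k H a * b) h) n := by
    refine ((action N (s + 1)).act_coe ⟨_, piBarR_mem (h 0)⟩ _).trans ?_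
    induction h using Fin.consCases with
    | _ g h =>
    rw [contractNth_zero_cons, tmul_cons, Fin.tail_cons, tmul_succ, smul_cons, Fin.cons_zero]
  change diff N (s + 1) (cons (h 0) (tmul k (Fin.tail h) n)) = _
  rw [diff_cons, h2, action_tmul]
  simp only [pow_succ, mul_neg, mul_one, neg_smul, neg_neg, Finset.sum_neg_distrib]
  abel

variable {N' : Type u} [AddCommGroup N'] [Module k N'] [Module H N'] [IsScalarTower k H N']

lemma map_act (f : N →ₗ[HL k H] N') (hf : ∀ (h : H) n, f (h • n) = h • f n) (s : ℕ) (h : H)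
    (x : Bar k H s N) :
    map f s ((action N s).act h x) = (action N' s).act h (map f s x) := by
  induction s generalizing h with
  | zero =>
    change f (h • (show N from x)) = h • f x
    exact hf h x
  | succ s ih => exact HAction.whisker_act (φ := map f s) ih h x

/-- Applied to right multiplications of `H`, this gives right linearity of `d'`; applied to the
orbit maps `h ↦ hn`, the comparison with `- ⊗_H N`; applied to module maps, naturality. -/
lemma diff_map (f : N →ₗ[HL k H] N') (hf : ∀ (h : H) n, f (h • n) = h • f n) (s : ℕ)
    (x : Bar k H (s + 1) N) : diff N' s (map f (s + 1) x) = map f s (diff N s x) :=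
  HAction.diff_whisker (φ := map f s) (map_act f hf s) x

variable (k H) in
/-- The bar differential with coefficients in `H`, as a map of right `H`-modules. -/
noncomputable def diffH (s : ℕ) : Bar k H (s + 1) H →ₗ[Hᵐᵒᵖ] Bar k H s H where
  toFun := diff H s
  map_add' := map_add _
  map_smul' a := diff_map (Module.toModuleEnd (HL k H) (S := Hᵐᵒᵖ) H a)
    (fun h n => (smul_comm h a n).symm) s

end Action

/-! ### The contraction -/

/-- The map `h ↦ -h̄ ⊗ 1`. -/
noncomputable def homotopyZero : H →ₗ[HL k H] Bar k H 1 H where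
  toFun h := -cons h (tmul k Fin.elim0 (1 : H))
  map_add' x y := by rw [add_cons, neg_add]
  map_smul' l x := by rw [RingHom.id_apply, smul_neg, smul_cons]; rfl

/-- The contraction `h̄₁ ⊗ ⋯ ⊗ h̄ₛ ⊗ h ↦ (-1)^{s+1} h̄₁ ⊗ ⋯ ⊗ h̄ₛ ⊗ h̄ ⊗ 1`. -/
noncomputable def homotopy : (s : ℕ) → (Bar k H s H →ₗ[HL k H] Bar k H (s + 1) H)
  | 0 => homotopyZero
  | s + 1 => -(HAction.whisker (homotopy s))

lemma homotopy_zero (h : Bar k H 0 H) :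
    homotopy 0 h = -cons (show H from h) (tmul k Fin.elim0 (1 : H)) := rfl

lemma homotopy_cons (s : ℕ) (h : H) (x : Bar k H s H) :
    homotopy (s + 1) (cons h x) = -cons h (homotopy s x) := rfl

/-- The defect of `H`-linearity of the contraction. In degree `0` it is the correction term of the
twist evaluated at `1`. Each twist preserves it: for `x = ḡ ⊗ y` everything cancels except `-h̄ ⊗
(g·σ(y) - σ(g·y))` and `h̄ ⊗ g·σ(y)`, which the induction hypothesis combines. -/
lemma act_homotopy (s : ℕ) (h : H) (x : Bar k H s H) :
    (action H (s + 1)).act h (homotopy s x) - homotopy s ((action H s).act h x) = cons h x := by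
  induction s generalizing h with
  | zero =>
    have h1 : (action H 0).act h (tmul k Fin.elim0 (1 : H)) = tmul k Fin.elim0 h := mul_one h
    have h2 : (action H 0).act (show H from x) (tmul k Fin.elim0 (1 : H)) = x :=
      mul_one (show H from x)
    have h3 : homotopy 0 ((action H 0).act h x) =
      -cons (h * (show H from x)) (tmul k Fin.elim0 (1 : H)) := rfl
    rw [h3, homotopy_zero, map_neg, action_cons, h2]
    abel
  | succ s ih =>
    induction x using cons_induction with
    | zero => simp only [map_zero, sub_zero, Bar.cons_zero]
    | add x y hx hy =>
      rw [cons_add, ← hx, ← hy]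
      simp only [map_add]
      abel
    | cons g x =>
      rw [homotopy_cons, action_cons, map_neg, map_sub, homotopy_cons, homotopy_cons, action_cons,
        ← ih, cons_sub]
      abel

/-- On `h̄ ⊗ y` the two terms with `Π̄^R(h)` cancel, because `σ` commutes with `H^L`. What is left
is `h·σ(y) - σ(h·y)`, which equals `h̄ ⊗ y` by `act_homotopy`. -/
lemma homotopy_diff (s : ℕ) (x : Bar k H (s + 1) H) :
    homotopy s (diff H s x) + diff H (s + 1) (homotopy (s + 1) x) = x := by
  induction x using cons_induction with
  | zero => simp only [map_zero, add_zero]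
  | add x y hx hy =>
    nth_rw 3 [← hx, ← hy]
    simp only [map_add]
    abel
  | cons h x =>
    have h1 (y : Bar k H s H) : homotopy s ((action H s).act (piBarR k H h) y) =
        (action H (s + 1)).act (piBarR k H h) (homotopy s y) := by
      rw [(action H s).act_coe ⟨_, piBarR_mem h⟩, (action H (s + 1)).act_coe ⟨_, piBarR_mem h⟩,
        map_smul]
    rw [homotopy_cons, map_neg, diff_cons, diff_cons, map_sub, h1, ← act_homotopy]
    abel

end Bar

end WeakHopf

/-! ### Right actions, and the powers of `H̄` as generators of the bar terms -/

namespace WeakHopf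

namespace Bar

section Bimodule

variable {k H : Type u} [Field k] [Ring H] [Algebra k H] [WeakBialgebra k H]

/-- The new last factor is `1`, and `\overline{hl} ⊗ 1 = h̄ ⊗ l = (h̄ ⊗ 1)·l`. The first equality
uses the relation over `H^L`, so the argument gives linearity over `H^L`, not over `H`. -/
lemma homotopy_op_smul (s : ℕ) (l : HL k H) (x : Bar k H s H) :
    homotopy s (op (l : H) • x) = op (l : H) • homotopy s x := by
  induction s with
  | zero =>
    have h1 : homotopy 0 (op (l : H) • x) =
      -cons ((show H from x) * l) (tmul k Fin.elim0 (1 : H)) := rfl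
    rw [h1, homotopy_zero, smul_neg, op_smul_cons, mul_coe_cons]
    congr 2
    change (l : H) * 1 = 1 * (l : H)
    rw [mul_one, one_mul]
  | succ s ih =>
    induction x using cons_induction with
    | zero => simp only [map_zero, smul_zero]
    | add x y hx hy => rw [smul_add, map_add, map_add, smul_add, hx, hy]
    | cons h x => rw [op_smul_cons, homotopy_cons, homotopy_cons, ih, smul_neg, op_smul_cons]

lemma smul_op_smul (s : ℕ) {N : Type u} [AddCommGroup N] [Module k N] [Module (HL k H) N]
    [IsScalarTower k (HL k H) N] {A : Type u} [Ring A] [Module Aᵐᵒᵖ N]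
    [SMulCommClass Aᵐᵒᵖ (HL k H) N] (a : Aᵐᵒᵖ) (l : HL k H) (x : Bar k H s N) :
    a • l • x = l • a • x :=
  (map (Module.toModuleEnd (HL k H) (S := Aᵐᵒᵖ) N a) s).map_smul l x

instance isScalarTower_right (s : ℕ) {N : Type u} [AddCommGroup N] [Module k N]
    [Module (HL k H) N] [IsScalarTower k (HL k H) N] {A : Type u} [Ring A] [Algebra k A]
    [Module Aᵐᵒᵖ N] [SMulCommClass Aᵐᵒᵖ (HL k H) N] [IsScalarTower k Aᵐᵒᵖ N] :
    IsScalarTower k Aᵐᵒᵖ (Bar k H s N) where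
  smul_assoc c a x := by
    induction x using Bar.induction_on with
    | zero => simp only [smul_zero]
    | add x y hx hy => simp only [smul_add, hx, hy]
    | tmul h n =>
      -- Scalars may be moved to the last factor, on which the right action takes place.
      have h1 (n : N) : c • tmul k h n = tmul k h (c • n) := by
        induction s with
        | zero => rfl
        | succ s ih => rw [tmul_succ, tmul_succ, ← ih, cons_smul]
      rw [op_smul_tmul, op_smul_tmul, h1, smul_assoc]

instance isScalarTower_hbar : IsScalarTower k (HL k H)ᵐᵒᵖ (Hbar k H) where
  smul_assoc c l x := by
    obtain ⟨h, rfl⟩ := Submodule.Quotient.mk_surjective _ x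
    exact congrArg (Hbar.mk k) (mul_smul_comm c h (l.unop : H))

variable (k H) in
/-- The map `h̄ ↦ h̄ ⊗ 1`. -/
noncomputable def insertOneZero : Hbar k H →ₗ[HL k H] Bar k H 1 H where
  toFun m := BalTensor.tmul k (HL k H) m (tmul k Fin.elim0 (1 : H))
  map_add' x y := BalTensor.add_tmul x y _
  map_smul' _ _ := rfl

variable (k H) in
/-- The map `h̄₁ ⊗ ⋯ ⊗ h̄ₛ₊₁ ↦ h̄₁ ⊗ ⋯ ⊗ h̄ₛ₊₁ ⊗ 1`. -/
noncomputable def insertOne : (s : ℕ) → (HbarPow k H s →ₗ[HL k H] Bar k H (s + 1) H)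
  | 0 => insertOneZero k H
  | s + 1 => HAction.whisker (insertOne s)

lemma insertOne_cons {s : ℕ} (h : H) (x : HbarPow k H s) :
    insertOne k H (s + 1) (cons h x) = cons h (insertOne k H s x) := rfl

lemma insertOne_zero_mk (h : H) :
    insertOne k H 0 (Hbar.mk k h : HbarPow k H 0) = cons h (tmul k Fin.elim0 (1 : H)) := rfl

lemma insertOne_op_smul {s : ℕ} (l : HL k H) (x : HbarPow k H s) :
    insertOne k H s (op l • x) = op (l : H) • insertOne k H s x := by
  induction s with
  | zero =>
    obtain ⟨h, rfl⟩ := Submodule.Quotient.mk_surjective (HLSubmodule k H) x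
    have h1 : insertOne k H 0 (op l • (Hbar.mk k h : HbarPow k H 0)) =
      cons (h * l) (tmul k Fin.elim0 (1 : H)) := rfl
    refine h1.trans ?_
    refine Eq.trans ?_ (congrArg (op (l : H) • ·) (insertOne_zero_mk h).symm)
    rw [op_smul_cons, mul_coe_cons]
    congr 1
    change (l : H) * 1 = 1 * (l : H)
    rw [mul_one, one_mul]
  | succ s ih =>
    induction x using cons_induction with
    | zero => simp only [map_zero, smul_zero]
    | add x y hx hy => rw [smul_add, map_add, map_add, smul_add, hx, hy]
    | cons h x => rw [op_smul_cons, insertOne_cons, insertOne_cons, ih, op_smul_cons]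

lemma insertOne_tmul {s : ℕ} (h : Fin (s + 1) → H) :
    insertOne k H s (HbarPow.tmul k h) = tmul k h (1 : H) := by
  induction s with
  | zero => rfl
  | succ s ih =>
    have h1 : HbarPow.tmul k h = cons (h 0) (HbarPow.tmul k (Fin.tail h)) := by
      rw [HbarPow.tmul, tmul_succ]
      rfl
    rw [h1, insertOne_cons, ih, tmul_succ (h := h)]

/-- Tensors ending in `1` generate the right `H`-module, as `h̄₁ ⊗ ⋯ ⊗ a = (h̄₁ ⊗ ⋯ ⊗ 1)·a`. This is
the uniqueness half of the correspondence between right `H^L`-linear and right `H`-linear maps. -/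
lemma insertOne_induction {s : ℕ} {motive : Bar k H (s + 1) H → Prop} (x : Bar k H (s + 1) H)
    (zero : motive 0) (smul : ∀ (y : HbarPow k H s) (a : H), motive (op a • insertOne k H s y))
    (add : ∀ x y, motive x → motive y → motive (x + y)) : motive x := by
  induction x using Bar.induction_on with
  | zero => exact zero
  | add x y hx hy => exact add x y hx hy
  | tmul h n =>
    have := smul (HbarPow.tmul k h) n
    rw [insertOne_tmul, op_smul_tmul] at this
    simpa using this

lemma hom_ext_insertOne {s : ℕ} {N : Type u} [AddCommGroup N] [Module Hᵐᵒᵖ N]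
    {f g : Bar k H (s + 1) H →ₗ[Hᵐᵒᵖ] N}
    (h : ∀ y : HbarPow k H s, f (insertOne k H s y) = g (insertOne k H s y)) : f = g := by
  ext x
  induction x using insertOne_induction with
  | zero => rw [map_zero, map_zero]
  | smul y a => rw [map_smul, map_smul, h]
  | add x y hx hy => rw [map_add, map_add, hx, hy]

end Bimodule

/-! ### Extension of right `H^L`-linear maps to right `H`-linear maps -/

section Extend

variable {k H : Type u} [Field k] [Ring H] [Algebra k H] [WeakBialgebra k H]
variable {N : Type u} [AddCommGroup N] [Module k N] [Module Hᵐᵒᵖ N] [IsScalarTower k Hᵐᵒᵖ N]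
variable {s : ℕ}

/-- The map `h ↦ β(h̄ ⊗ -)`. -/
noncomputable def precomp_cons (b : HomHL k H N (s + 1)) : H →ₗ[k] HomHL k H N s where
  toFun h := ⟨b.1 ∘ₗ consₗ k (Hbar k H) s h, fun l x => b.2 l (cons h x)⟩
  map_add' g h := Subtype.ext (LinearMap.ext fun x =>
    (congrArg b.1 (add_cons g h x)).trans (b.1.map_add _ _))
  map_smul' c h := Subtype.ext (LinearMap.ext fun x =>
    (congrArg b.1 (BalTensor.smul_tmul' (k := k) (R := HL k H) c (Hbar.mk k h) x)).trans
      (b.1.map_smul _ _))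

/-- The map `β ↦ β(l · -)`. -/
noncomputable def precomp_smul (l : HL k H) (b : HomHL k H N s) : HomHL k H N s :=
  ⟨b.1 ∘ₗ (Algebra.lsmul k k (HbarPow k H s) l), fun m x => by
    change b.1 (l • op m • x) = _ • b.1 (l • x)
    rw [← smul_op_smul, b.2]⟩

/-- The linear map `h̄ ⊗ x ↦ E(β(h̄ ⊗ -))(x)`. -/
noncomputable def extendSucc (E : HomHL k H N s →ₗ[k] Bar k H (s + 1) H →ₗ[k] N)
    (hE : ∀ l b x, E (precomp_smul l b) x = E b (l • x)) (b : HomHL k H N (s + 1)) :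
    Bar k H (s + 2) H →ₗ[k] N :=
  consLift (E ∘ₗ precomp_cons b)
    (fun h hh => by
      have h1 : precomp_cons b h = 0 := Subtype.ext (LinearMap.ext fun x => by
        change b.1 (cons h x) = 0
        rw [cons_of_mem hh, map_zero])
      rw [LinearMap.comp_apply, h1, map_zero])
    -- Balancedness over `H^L` at the new first factor is exactly the compatibility `hE` of the
    -- previous stage, which is why the recursion carries that property along.
    (fun h l x => by
      have h1 : precomp_cons b (h * l) = precomp_smul l (precomp_cons b h) :=
        Subtype.ext (LinearMap.ext fun y => congrArg b.1 (mul_coe_cons h l y))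
      rw [LinearMap.comp_apply, LinearMap.comp_apply, h1, hE])

lemma extendSucc_cons (E : HomHL k H N s →ₗ[k] Bar k H (s + 1) H →ₗ[k] N)
    (hE : ∀ l b x, E (precomp_smul l b) x = E b (l • x)) (b : HomHL k H N (s + 1)) (h : H)
    (x : Bar k H (s + 1) H) :
    extendSucc E hE b (cons h x) = E (precomp_cons b h) x := rfl

/-- The map `h̄ ⊗ g ↦ β(h̄) · g`. -/
noncomputable def extendZeroAux (b : HomHL k H N 0) :
    BalTensor k (HL k H) (Hbar k H) H →ₗ[k] N :=
  BalTensor.lift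
    (LinearMap.mk₂ k (fun (m : Hbar k H) (g : H) => op g • b.1 m)
      (fun m m' g => (congrArg (op g • ·) (b.1.map_add m m')).trans (smul_add _ _ _))
      (fun c m g => (congrArg (op g • ·) (b.1.map_smul c m)).trans (smul_comm _ _ _))
      (fun m g g' => add_smul (op g) (op g') (b.1 m))
      (fun c m g => smul_assoc c (op g) (b.1 m)))
    (fun m l g => by
      refine (congrArg (op g • ·) (b.2 l m)).trans ?_
      exact (mul_smul (op g) (op (l : H)) (b.1 m)).symm)

/-- The map `h̄ ⊗ g ↦ β(h̄) · g`, on `H̄ ⊗_{H^L} H` seen as the first term of the bar complex. -/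
noncomputable def extendZero (b : HomHL k H N 0) : Bar k H 1 H →ₗ[k] N := extendZeroAux b

lemma extendZero_cons (b : HomHL k H N 0) (h : H) (x : Bar k H 0 H) :
    extendZero b (cons h x) = op (show H from x) • b.1 (Hbar.mk k h) := rfl

variable (k H N) in
/-- `extendZero` as a linear map. -/
noncomputable def extendZeroₗ : HomHL k H N 0 →ₗ[k] Bar k H 1 H →ₗ[k] N where
  toFun := extendZero
  map_add' b c := by
    ext x
    induction x using cons_induction with
    | zero => rw [map_zero, map_zero]
    | add x y hx hy => rw [map_add, map_add, hx, hy]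
    | cons h x => exact smul_add (op (show H from x)) (b.1 (Hbar.mk k h)) (c.1 (Hbar.mk k h))
  map_smul' c b := by
    ext x
    induction x using cons_induction with
    | zero => rw [map_zero, map_zero]
    | add x y hx hy => rw [map_add, map_add, hx, hy]
    | cons h x => exact smul_comm (op (show H from x)) c (b.1 (Hbar.mk k h))

lemma extendZeroₗ_smul (l : HL k H) (b : HomHL k H N 0) (x : Bar k H 1 H) :
    extendZeroₗ k H N (precomp_smul l b) x = extendZeroₗ k H N b (l • x) := by
  change extendZero _ x = extendZero b (l • x)
  induction x using cons_induction with
  | zero => rw [smul_zero, map_zero, map_zero]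
  | add x y hx hy => rw [smul_add, map_add, map_add, hx, hy]
  | cons h x =>
    rw [smul_cons, extendZero_cons, extendZero_cons]
    rfl

lemma precomp_cons_add (b c : HomHL k H N (s + 1)) (h : H) :
    precomp_cons (b + c) h = precomp_cons b h + precomp_cons c h := rfl

lemma precomp_cons_smul (r : k) (b : HomHL k H N (s + 1)) (h : H) :
    precomp_cons (r • b) h = r • precomp_cons b h := rfl

lemma precomp_cons_precomp_smul (l : HL k H) (b : HomHL k H N (s + 1)) (h : H) :
    precomp_cons (precomp_smul l b) h = precomp_cons b (l * h) := rfl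

/-- `extendSucc` as a linear map. -/
noncomputable def extendSuccₗ (E : HomHL k H N s →ₗ[k] Bar k H (s + 1) H →ₗ[k] N)
    (hE : ∀ l b x, E (precomp_smul l b) x = E b (l • x)) :
    HomHL k H N (s + 1) →ₗ[k] Bar k H (s + 2) H →ₗ[k] N where
  toFun := extendSucc E hE
  map_add' b c := by
    ext x
    induction x using cons_induction with
    | zero => rw [map_zero, map_zero]
    | add x y hx hy => rw [map_add, map_add, hx, hy]
    | cons h x =>
      rw [LinearMap.add_apply, extendSucc_cons, extendSucc_cons, extendSucc_cons,
        precomp_cons_add, map_add, LinearMap.add_apply]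
  map_smul' c b := by
    ext x
    induction x using cons_induction with
    | zero => rw [map_zero, map_zero]
    | add x y hx hy => rw [map_add, map_add, hx, hy]
    | cons h x =>
      rw [RingHom.id_apply, LinearMap.smul_apply, extendSucc_cons, extendSucc_cons,
        precomp_cons_smul, map_smul, LinearMap.smul_apply]

lemma extendSuccₗ_smul (E : HomHL k H N s →ₗ[k] Bar k H (s + 1) H →ₗ[k] N)
    (hE : ∀ l b x, E (precomp_smul l b) x = E b (l • x)) (l : HL k H) (b : HomHL k H N (s + 1))
    (x : Bar k H (s + 2) H) :
    extendSuccₗ E hE (precomp_smul l b) x = extendSuccₗ E hE b (l • x) := by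
  change extendSucc E hE _ x = extendSucc E hE b (l • x)
  induction x using cons_induction with
  | zero => rw [smul_zero, map_zero, map_zero]
  | add x y hx hy => rw [smul_add, map_add, map_add, hx, hy]
  | cons h x => rw [smul_cons, extendSucc_cons, extendSucc_cons, precomp_cons_precomp_smul]

variable (k H N) in
/-- The extension of right `H^L`-linear maps on `H̄^{⊗ (s+1)}` to `H̄^{⊗ (s+1)} ⊗_{H^L} H`, with
its compatibility with the left action of `H^L`. -/
noncomputable def extendAux : (s : ℕ) → {E : HomHL k H N s →ₗ[k] Bar k H (s + 1) H →ₗ[k] N //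
    ∀ l b x, E (precomp_smul l b) x = E b (l • x)}
  | 0 => ⟨extendZeroₗ k H N, extendZeroₗ_smul⟩
  | s + 1 => ⟨extendSuccₗ (extendAux s).1 (extendAux s).2,
      extendSuccₗ_smul (extendAux s).1 (extendAux s).2⟩

lemma extendAux_cons (b : HomHL k H N (s + 1)) (h : H) (x : Bar k H (s + 1) H) :
    (extendAux k H N (s + 1)).1 b (cons h x) = (extendAux k H N s).1 (precomp_cons b h) x := rfl

lemma extendAux_insertOne (b : HomHL k H N s) (y : HbarPow k H s) :
    (extendAux k H N s).1 b (insertOne k H s y) = b.1 y := by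
  induction s with
  | zero => exact one_smul Hᵐᵒᵖ (b.1 y)
  | succ s ih =>
    induction y using cons_induction with
    | zero => simp only [map_zero]
    | add x y hx hy => simp only [map_add, hx, hy]
    | cons h x =>
      rw [insertOne_cons, extendAux_cons, ih]
      rfl

lemma extendAux_op_smul (b : HomHL k H N s) (a : H) (x : Bar k H (s + 1) H) :
    (extendAux k H N s).1 b (op a • x) = op a • (extendAux k H N s).1 b x := by
  induction s with
  | zero =>
    induction x using cons_induction with
    | zero => simp only [map_zero, smul_zero]
    | add x y hx hy => simp only [map_add, smul_add, hx, hy]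
    | cons h x => exact mul_smul (op a) (op (show H from x)) (b.1 (Hbar.mk k h))
  | succ s ih =>
    induction x using cons_induction with
    | zero => simp only [map_zero, smul_zero]
    | add x y hx hy => simp only [map_add, smul_add, hx, hy]
    | cons h x => rw [op_smul_cons, extendAux_cons, extendAux_cons, ih]

/-- The extension of a right `H^L`-linear map on `H̄^{⊗ (s+1)}` to a right `H`-linear map on
`H̄^{⊗ (s+1)} ⊗_{H^L} H`. -/
noncomputable def extend (b : HomHL k H N s) : Bar k H (s + 1) H →ₗ[Hᵐᵒᵖ] N where
  toFun := (extendAux k H N s).1 b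
  map_add' := map_add _
  map_smul' a x := extendAux_op_smul b a.unop x

lemma extend_insertOne (b : HomHL k H N s) (y : HbarPow k H s) :
    extend b (insertOne k H s y) = b.1 y := extendAux_insertOne b y

end Extend

end Bar

end WeakHopf

namespace WeakHopf

namespace Bar

/-! ### Contractibility and exactness -/

section Exact

variable {k H : Type u} [Field k] [Ring H] [Algebra k H] [WeakBialgebra k H]

/-- `Π^R(hx)` depends on `h` only through `Π^R(h)`, and `Π^R` takes the same value on `h` and on
`Π̄^R(h)`. -/
lemma augmentation_diffH (x : Bar k H 1 H) : augmentation k H (diffH k H 0 x) = 0 := by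
  induction x using cons_induction with
  | zero => rw [map_zero, map_zero]
  | add x y hx hy => rw [map_add, map_add, hx, hy, add_zero]
  | cons h x =>
    have h1 : diffH k H 0 (cons h x) = (show Bar k H 0 H from
      piBarR k H h * (show H from x) - h * (show H from x)) := rfl
    rw [h1]
    refine Subtype.ext ?_
    change piR k H (piBarR k H h * (show H from x) - h * (show H from x)) = 0
    rw [map_sub, ← piR_mul, piR_piBarR, piR_mul, sub_self]

variable (k H) in
/-- The section `Π^R(h) ↦ Π̄^R(h)` of the augmentation. -/
noncomputable def augmentationSection : HR k H →ₗ[k] Bar k H 0 H :=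
  (piBarR k H ∘ₗ (HR k H).subtype : HR k H →ₗ[k] H)

lemma augmentationSection_apply (y : HR k H) :
    augmentationSection k H y = (show Bar k H 0 H from piBarR k H (y : H)) := rfl

/-- The action on `H^R` involves `Π^R`, but `Π̄^R` absorbs it and is itself right `H^L`-linear. -/
lemma augmentationSection_op_smul (l : HL k H) (y : HR k H) :
    augmentationSection k H (op (l : H) • y) = op (l : H) • augmentationSection k H y := by
  change piBarR k H (piR k H (y * l)) = piBarR k H y * l
  rw [piBarR_piR, piBarR_mul_of_mem _ l.2]

lemma augmentation_section (y : HR k H) : augmentation k H (augmentationSection k H y) = y :=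
  Subtype.ext ((piR_piBarR (y : H)).trans (piR_of_mem y))

/-- The homotopy contributes `x - Π̄^R(x)`, and the section after the augmentation contributes
`Π̄^R(Π^R(x)) = Π̄^R(x)`. -/
lemma section_augmentation (x : Bar k H 0 H) :
    augmentationSection k H (augmentation k H x) + diffH k H 0 (homotopy 0 x) = x := by
  have h1 : diffH k H 0 (homotopy 0 x) =
      -(show Bar k H 0 H from piBarR k H (show H from x) * 1 - (show H from x) * 1) := by
    rw [homotopy_zero]
    exact map_neg (diffH k H 0) _
  rw [h1, augmentationSection_apply]
  change piBarR k H (piR k H (show H from x)) +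
    -(piBarR k H (show H from x) * 1 - (show H from x) * 1) = (show H from x)
  rw [piBarR_piR, mul_one, mul_one]
  abel

variable (k H) in
lemma augmentation_surjective : Function.Surjective (augmentation k H) :=
  fun y => ⟨_, augmentation_section y⟩

variable (k H) in
lemma exact_augmentation : Function.Exact (diffH k H 0) (augmentation k H) := fun x =>
  ⟨fun hx => ⟨homotopy 0 x, by simpa [hx] using section_augmentation x⟩,
    by rintro ⟨y, rfl⟩; exact augmentation_diffH y⟩

lemma diffH_diffH (s : ℕ) (x : Bar k H (s + 2) H) : diffH k H s (diffH k H (s + 1) x) = 0 :=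
  diff_diff s x

variable (k H) in
-- Exactness concerns only underlying sets, so a homotopy that is not `H`-linear suffices.
lemma exact_diffH (s : ℕ) : Function.Exact (diffH k H (s + 1)) (diffH k H s) := fun x =>
  ⟨fun hx => ⟨homotopy (s + 1) x, by
      have h1 := homotopy_diff s x
      have h2 : diff H s x = 0 := hx
      rw [h2, map_zero, zero_add] at h1
      exact h1⟩,
    by rintro ⟨y, rfl⟩; exact diffH_diffH s y⟩

end Exact

/-! ### Projectivity -/

section Projective

variable {k H : Type u} [Field k] [Ring H] [Algebra k H]

variable (H) in
lemma projective_self_op : Module.Projective Hᵐᵒᵖ H :=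
  .of_equiv' (R := Hᵐᵒᵖ) (M := Hᵐᵒᵖ)
    { toFun := unop
      map_add' := fun _ _ => rfl
      map_smul' := fun _ _ => rfl
      invFun := op
      left_inv := fun _ => rfl
      right_inv := fun _ => rfl }

variable [WeakHopfAlgebra k H] {s : ℕ}

variable (k H s) in
/-- The map `h ⊗ x ↦ (x ⊗ 1) · h`. -/
noncomputable def retraction : H ⊗[k] HbarPow k H s →ₗ[Hᵐᵒᵖ] Bar k H (s + 1) H :=
  have h1 (g : H) (t) : TensorProduct.lift (LinearMap.mk₂ k
      (fun (h : H) (x : HbarPow k H s) => op h • insertOne k H s x)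
      (fun a b x => add_smul (op a) (op b) (insertOne k H s x))
      (fun c a x => smul_assoc c (op a) (insertOne k H s x))
      (fun a x y => by rw [map_add, smul_add])
      (fun c a x => by rw [LinearMap.map_smul_of_tower, smul_comm])) (op g • t) = op g •
    TensorProduct.lift (LinearMap.mk₂ k
      (fun (h : H) (x : HbarPow k H s) => op h • insertOne k H s x)
      (fun a b x => add_smul (op a) (op b) (insertOne k H s x))
      (fun c a x => smul_assoc c (op a) (insertOne k H s x))
      (fun a x y => by rw [map_add, smul_add])
      (fun c a x => by rw [LinearMap.map_smul_of_tower, smul_comm])) t := by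
    induction t with
    | zero => simp
    | add x y hx hy => rw [smul_add, map_add, map_add, smul_add, hx, hy]
    | tmul h x => exact mul_smul (op g) (op h) (insertOne k H s x)
  { TensorProduct.lift (LinearMap.mk₂ k
      (fun (h : H) (x : HbarPow k H s) => op h • insertOne k H s x)
      (fun a b x => add_smul (op a) (op b) (insertOne k H s x))
      (fun c a x => smul_assoc c (op a) (insertOne k H s x))
      (fun a x y => by rw [map_add, smul_add])
      (fun c a x => by rw [LinearMap.map_smul_of_tower, smul_comm])) with
    map_smul' := fun a => h1 a.unop }

lemma retraction_tmul (h : H) (x : HbarPow k H s) :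
    retraction k H s (h ⊗ₜ[k] x) = op h • insertOne k H s x := rfl

/-- The map `l ⊗ h ↦ h ⊗ x · l`. -/
noncomputable def swapAct (x : HbarPow k H s) : HL k H ⊗[k] H →ₗ[k] H ⊗[k] HbarPow k H s :=
  TensorProduct.lift (LinearMap.mk₂ k (fun (l : HL k H) (h : H) => h ⊗ₜ[k] (op l • x))
    (fun l m h => by rw [MulOpposite.op_add, add_smul, TensorProduct.tmul_add])
    (fun c l h => by rw [MulOpposite.op_smul, smul_assoc, TensorProduct.tmul_smul])
    (fun l g h => TensorProduct.add_tmul _ _ _)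
    (fun c l h => rfl))

lemma swapAct_tmul (x : HbarPow k H s) (l : HL k H) (h : H) :
    swapAct x (l ⊗ₜ[k] h) = h ⊗ₜ[k] (op l • x) := rfl

/-- Splitting `x` along `t` and recombining acts by the product of the legs of `t`. For the
separability element this product is `1`. -/
lemma retraction_swapAct (x : HbarPow k H s) (t : HL k H ⊗[k] H) :
    retraction k H s (swapAct x t) =
      op (LinearMap.mul' k H (LinearMap.rTensor H (HL k H).val.toLinearMap t)) •
        insertOne k H s x := by
  induction t with
  | zero => simp
  | add x y hx hy => simp only [map_add, MulOpposite.op_add, add_smul, hx, hy]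
  | tmul l h =>
    rw [swapAct_tmul, retraction_tmul, insertOne_op_smul, ← mul_smul]
    rfl

variable (k H s) in
/-- The right `H^L`-linear map `x ↦ 1⁽²⁾ ⊗ x · Π^L(1⁽¹⁾)`. -/
noncomputable def sepMap : HomHL k H (H ⊗[k] HbarPow k H s) s :=
  ⟨{ toFun := fun x => swapAct x (sepElem k H)
     map_add' := fun x y => by
      generalize sepElem k H = t
      induction t with
      | zero => simp
      | add a b ha hb => simp only [map_add, ha, hb]; abel
      | tmul l h => simp only [swapAct_tmul, smul_add, TensorProduct.tmul_add]
     map_smul' := fun c x => by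
      generalize sepElem k H = t
      induction t with
      | zero => simp
      | add a b ha hb => simp only [map_add, smul_add, ha, hb]
      | tmul l h =>
        rw [RingHom.id_apply, swapAct_tmul, swapAct_tmul, smul_comm, TensorProduct.tmul_smul] },
  fun l x => by
    change swapAct (op l • x) (sepElem k H) = op (l : H) • swapAct x (sepElem k H)
    have h1 (t) : swapAct (op l • x) t = swapAct x (LinearMap.rTensor H (LinearMap.mulLeft k l) t) := by
      induction t with
      | zero => simp
      | add a b ha hb => simp only [map_add, ha, hb]
      | tmul m h => rw [LinearMap.rTensor_tmul, swapAct_tmul, swapAct_tmul, ← mul_smul]; rfl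
    have h2 (t) : op (l : H) • swapAct x t =
        swapAct x (LinearMap.lTensor (HL k H) (LinearMap.mulRight k (l : H)) t) := by
      induction t with
      | zero => simp
      | add a b ha hb => simp only [map_add, smul_add, ha, hb]
      | tmul m h => rfl
    -- Right `H^L`-linearity of the splitting is precisely the centrality of the separability
    -- element.
    rw [h1, h2, lTensor_mulRight_sepElem]⟩

instance projective (s : ℕ) : Module.Projective Hᵐᵒᵖ (Bar k H s H) := by
  have := projective_self_op H
  cases s with
  | zero => exact this
  | succ s =>
    -- The ambient module is projective: `H` is free of rank one over itself on the right, and the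
    -- other factor is a vector space.
    refine .of_split (M := H ⊗[k] HbarPow k H s) (extend (sepMap k H s)) (retraction k H s) ?_
    refine hom_ext_insertOne fun y => ?_
    rw [LinearMap.comp_apply, extend_insertOne]
    refine (retraction_swapAct y _).trans ?_
    rw [mul'_sepElem, op_one, one_smul, LinearMap.id_apply]

end Projective

end Bar

/-! ### The projective resolution of `H^R` -/

section Resolution

variable (k H : Type u) [Field k] [Ring H] [Algebra k H] [WeakHopfAlgebra k H]

/-- The bar complex with coefficients in `H`, as a complex of right `H`-modules. -/
noncomputable def barComplexH : ChainComplex (ModuleCat.{u} Hᵐᵒᵖ) ℕ :=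
  ChainComplex.of (fun s => ModuleCat.of Hᵐᵒᵖ (Bar k H s H))
    (fun s => ModuleCat.ofHom (Bar.diffH k H s))
    (fun s => by ext1; exact LinearMap.ext (Bar.diffH_diffH s))

lemma barComplexH_d (s : ℕ) :
    (barComplexH k H).d (s + 1) s = ModuleCat.ofHom (Bar.diffH k H s) :=
  ChainComplex.of_d (fun s => ModuleCat.of Hᵐᵒᵖ (Bar k H s H))
    (fun s => ModuleCat.ofHom (Bar.diffH k H s)) s

/-- The augmentation of the bar complex. -/
noncomputable def barComplexHπ :
    barComplexH k H ⟶ (ChainComplex.single₀ _).obj (ModuleCat.of Hᵐᵒᵖ (HR k H)) :=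
  ((barComplexH k H).toSingle₀Equiv _).symm ⟨ModuleCat.ofHom (augmentation k H), by
    rw [barComplexH_d]
    ext1
    exact LinearMap.ext Bar.augmentation_diffH⟩

lemma barComplexHπ_f_zero : (barComplexHπ k H).f 0 = ModuleCat.ofHom (augmentation k H) :=
  ChainComplex.toSingle₀Equiv_symm_apply_f_zero _ _

instance : QuasiIso (barComplexHπ k H) where
  quasiIsoAt m := by
    cases m with
    | zero =>
      -- In degree `0` the claim amounts to exactness at `H` and surjectivity of the augmentation.
      rw [ChainComplex.quasiIsoAt₀_iff, ShortComplex.quasiIso_iff_of_zeros' _ rfl rfl rfl]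
      refine (ShortComplex.exact_and_epi_g_iff_of_iso (S₂ := ShortComplex.mk
        (ModuleCat.ofHom (Bar.diffH k H 0)) (ModuleCat.ofHom (augmentation k H)) (by
          ext1; exact LinearMap.ext Bar.augmentation_diffH)) ?_).2 ⟨?_, ?_⟩
      · exact ShortComplex.isoMk (Iso.refl _) (Iso.refl _) (Iso.refl _)
          ((Category.id_comp _).trans
            ((barComplexH_d k H 0).symm.trans (Category.comp_id _).symm))
          ((Category.id_comp _).trans
            ((barComplexHπ_f_zero k H).symm.trans (Category.comp_id _).symm))
      · rw [ShortComplex.ShortExact.moduleCat_exact_iff_function_exact]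
        exact Bar.exact_augmentation k H
      · exact (ModuleCat.epi_iff_surjective _).2 (Bar.augmentation_surjective k H)
    | succ m =>
      -- In positive degrees the target complex is exact, so only exactness of the bar complex has
      -- to be shown.
      rw [quasiIsoAt_iff_exactAt' (hL := ChainComplex.exactAt_succ_single_obj ..),
        HomologicalComplex.exactAt_iff' _ (m + 2) (m + 1) m (by simp) (by simp),
        ShortComplex.ShortExact.moduleCat_exact_iff_function_exact]
      have h1 := Bar.exact_diffH k H m
      change Function.Exact ((barComplexH k H).d (m + 2) (m + 1)).hom
        ((barComplexH k H).d (m + 1) m).hom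
      rw [barComplexH_d, barComplexH_d]
      exact h1

/-- The bar resolution of the right `H`-module `H^R`. -/
noncomputable def barResolution : ProjectiveResolution (ModuleCat.of Hᵐᵒᵖ (HR k H)) where
  complex := barComplexH k H
  projective s := (IsProjective.iff_projective (Bar k H s H)).1 (Bar.projective s)
  π := barComplexHπ k H

end Resolution

end WeakHopf

namespace WeakHopf

namespace Bar

/-! ### The isomorphism `(H̄^{⊗ s} ⊗_{H^L} H) ⊗_H N ≅ H̄^{⊗ s} ⊗_{H^L} N` -/

section TensorSelf

variable {k H : Type u} [Field k] [Ring H] [Algebra k H] [WeakBialgebra k H]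
variable {N : Type u} [AddCommGroup N] [Module k N] [Module H N] {s : ℕ}

variable (k H N s) in
/-- The map `h̄ ⊗ -` on the first factor of the tensor product over `H`. -/
noncomputable def consTensor (h : H) :
    BalTensor k H (Bar k H s H) N →ₗ[k] BalTensor k H (Bar k H (s + 1) H) N :=
  BalTensor.map (consₗ k H s h) LinearMap.id (fun _ _ => rfl) (fun _ _ => rfl)

lemma consTensor_tmul (h : H) (x : Bar k H s H) (n : N) :
    consTensor k H N s h (BalTensor.tmul k H x n) = BalTensor.tmul k H (cons h x) n := rfl

variable (k H N s) in
/-- The left action of `H^L` on the first factor of the tensor product over `H`. -/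
noncomputable def smulTensor (l : HL k H) :
    BalTensor k H (Bar k H s H) N →ₗ[k] BalTensor k H (Bar k H s H) N :=
  BalTensor.map (Algebra.lsmul k k (Bar k H s H) l) LinearMap.id
    (fun r m => (smul_op_smul s (op r) l m).symm) (fun _ _ => rfl)

lemma smulTensor_tmul (l : HL k H) (x : Bar k H s H) (n : N) :
    smulTensor k H N s l (BalTensor.tmul k H x n) = BalTensor.tmul k H (l • x) n := rfl

lemma consTensor_add (g h : H) (t : BalTensor k H (Bar k H s H) N) :
    consTensor k H N s (g + h) t = consTensor k H N s g t + consTensor k H N s h t := by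
  induction t using BalTensor.induction_on with
  | zero => simp only [map_zero, add_zero]
  | add x y hx hy => simp only [map_add, hx, hy]; abel
  | tmul x n => simp only [consTensor_tmul, add_cons, BalTensor.add_tmul]

lemma smul_cons' (c : k) (h : H) {M : Type u} [AddCommGroup M] [Module k M] [Module (HL k H) M]
    [IsScalarTower k (HL k H) M] (x : Bar k H s M) : cons (c • h) x = c • cons h x :=
  BalTensor.smul_tmul' (k := k) (R := HL k H) c (Hbar.mk k h) x

lemma consTensor_smul (c : k) (h : H) (t : BalTensor k H (Bar k H s H) N) :
    consTensor k H N s (c • h) t = c • consTensor k H N s h t := by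
  induction t using BalTensor.induction_on with
  | zero => simp only [map_zero, smul_zero]
  | add x y hx hy => simp only [map_add, smul_add, hx, hy]
  | tmul x n => simp only [consTensor_tmul, smul_cons', BalTensor.smul_tmul']

lemma consTensor_of_mem {h : H} (hh : h ∈ HL k H) (t : BalTensor k H (Bar k H s H) N) :
    consTensor k H N s h t = 0 := by
  induction t using BalTensor.induction_on with
  | zero => rw [map_zero]
  | add x y hx hy => rw [map_add, hx, hy, add_zero]
  | tmul x n => rw [consTensor_tmul, cons_of_mem hh, BalTensor.zero_tmul]

lemma consTensor_mul_coe (h : H) (l : HL k H) (t : BalTensor k H (Bar k H s H) N) :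
    consTensor k H N s (h * l) t = consTensor k H N s h (smulTensor k H N s l t) := by
  induction t using BalTensor.induction_on with
  | zero => simp only [map_zero]
  | add x y hx hy => simp only [map_add, hx, hy]
  | tmul x n => rw [consTensor_tmul, smulTensor_tmul, consTensor_tmul, mul_coe_cons]

lemma smulTensor_consTensor (l : HL k H) (h : H) (t : BalTensor k H (Bar k H s H) N) :
    smulTensor k H N (s + 1) l (consTensor k H N s h t) = consTensor k H N s (l * h) t := by
  induction t using BalTensor.induction_on with
  | zero => simp only [map_zero]
  | add x y hx hy => simp only [map_add, hx, hy]
  | tmul x n => rfl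

variable [IsScalarTower k H N]

/-- The map `h ↦ h · n`. -/
noncomputable def orbitMap (n : N) : H →ₗ[HL k H] N where
  toFun h := h • n
  map_add' g h := add_smul g h n
  map_smul' l h := mul_smul (l : H) h n

lemma tmul_smul (h : Fin s → H) (c : k) (n : N) : tmul k h (c • n) = c • tmul k h n := by
  induction s with
  | zero => rfl
  | succ s ih => rw [tmul_succ, tmul_succ, ih, cons_smul]

variable (k H N s) in
/-- The map `(h₁ ⊗ ⋯ ⊗ hₛ ⊗ h) ⊗ n ↦ h₁ ⊗ ⋯ ⊗ hₛ ⊗ h · n`. -/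
noncomputable def evalTensor : BalTensor k H (Bar k H s H) N →ₗ[k] Bar k H s N :=
  BalTensor.lift
    (LinearMap.mk₂ k (fun x n => map (orbitMap (k := k) n) s x)
      (fun x y n => map_add _ x y)
      (fun c x n => LinearMap.map_smul_of_tower _ c x)
      (fun x n n' => by
        induction x using Bar.induction_on with
        | zero => simp only [map_zero, add_zero]
        | add x y hx hy => simp only [map_add, hx, hy]; abel
        | tmul h a =>
          simp only [map_tmul, ← tmul_add]
          exact congrArg _ (smul_add a n n'))
      (fun c x n => by
        induction x using Bar.induction_on with
        | zero => simp only [map_zero, smul_zero]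
        | add x y hx hy => simp only [map_add, smul_add, hx, hy]
        | tmul h a =>
          simp only [map_tmul, ← tmul_smul]
          exact congrArg _ (smul_comm a c n)))
    (fun x r n => by
      simp only [LinearMap.mk₂_apply]
      induction x using Bar.induction_on with
      | zero => simp only [map_zero, smul_zero]
      | add x y hx hy => simp only [map_add, smul_add, hx, hy]
      | tmul h a =>
        simp only [op_smul_tmul, map_tmul]
        exact congrArg _ (mul_smul a r n))

lemma evalTensor_apply (x : Bar k H s H) (n : N) :
    evalTensor k H N s (BalTensor.tmul k H x n) = map (orbitMap n) s x := rfl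

lemma evalTensor_tmul (h : Fin s → H) (a : H) (n : N) :
    evalTensor k H N s (BalTensor.tmul k H (tmul k h a) n) = tmul k h (a • n) := by
  rw [evalTensor_apply, map_tmul]
  rfl

lemma map_orbitMap {N' : Type u} [AddCommGroup N'] [Module k N'] [Module H N']
    [IsScalarTower k H N'] (f : N →ₗ[HL k H] N') (hf : ∀ (h : H) n, f (h • n) = h • f n)
    (n : N) (x : Bar k H s H) :
    map (orbitMap (k := k) (f n)) s x = map f s (map (orbitMap (k := k) n) s x) := by
  induction x using Bar.induction_on with
  | zero => simp only [map_zero]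
  | add x y hx hy => simp only [map_add, hx, hy]
  | tmul h a =>
    rw [map_tmul, map_tmul, map_tmul]
    exact congrArg _ (hf a n).symm

/-- For fixed `n`, evaluation is induced by the left `H`-linear map `h ↦ hn`, so naturality of the
bar differential in its coefficients applies. -/
lemma evalTensor_diffH (t : BalTensor k H (Bar k H (s + 1) H) N) :
    evalTensor k H N s (BalTensor.map ((diffH k H s).restrictScalars k) LinearMap.id
      (fun r m => (diffH k H s).map_smul (op r) m) (fun _ _ => rfl) t) =
      diff N s (evalTensor k H N (s + 1) t) := by
  induction t using BalTensor.induction_on with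
  | zero => simp only [map_zero]
  | add x y hx hy => simp only [map_add, hx, hy]
  | tmul x n => exact (diff_map (orbitMap n) (fun g h => mul_smul g h n) s x).symm

lemma evalTensor_map {N' : Type u} [AddCommGroup N'] [Module k N'] [Module H N']
    [IsScalarTower k H N'] (f : N →ₗ[H] N') (t : BalTensor k H (Bar k H s H) N) :
    evalTensor k H N' s (BalTensor.map LinearMap.id (f.restrictScalars k) (fun _ _ => rfl)
      (fun r n => f.map_smul r n) t) =
      map (f.restrictScalars (HL k H)) s (evalTensor k H N s t) := by
  induction t using BalTensor.induction_on with
  | zero => simp only [map_zero]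
  | add x y hx hy => simp only [map_add, hx, hy]
  | tmul x n => exact map_orbitMap (f.restrictScalars (HL k H)) (fun h n => f.map_smul h n) n x

variable (k H N) in
/-- The map `n ↦ 1 ⊗ n`. -/
noncomputable def tensorOneZero : Bar k H 0 N →ₗ[k] BalTensor k H (Bar k H 0 H) N :=
  (BalTensor.mk k H (Bar k H 0 H) N (tmul k Fin.elim0 (1 : H)) : N →ₗ[k] _)

lemma tensorOneZero_smul (l : HL k H) (x : Bar k H 0 N) :
    tensorOneZero k H N (l • x) = smulTensor k H N 0 l (tensorOneZero k H N x) := by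
  have h1 : tensorOneZero k H N (l • x) = BalTensor.tmul k H
    (tmul k Fin.elim0 (1 : H) : Bar k H 0 H) ((l : H) • (show N from x)) := rfl
  have h2 : smulTensor k H N 0 l (tensorOneZero k H N x) = BalTensor.tmul k H
    (l • (tmul k Fin.elim0 (1 : H) : Bar k H 0 H)) (show N from x) := rfl
  rw [h1, h2, ← BalTensor.smul_tmul]
  congr 1
  exact (one_mul (l : H)).trans (mul_one (l : H)).symm

/-- The map `h̄ ⊗ x ↦ h̄ ⊗ φ(x)`. -/
noncomputable def tensorOneSucc (φ : Bar k H s N →ₗ[k] BalTensor k H (Bar k H s H) N)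
    (hφ : ∀ l x, φ (l • x) = smulTensor k H N s l (φ x)) :
    Bar k H (s + 1) N →ₗ[k] BalTensor k H (Bar k H (s + 1) H) N :=
  consLift (LinearMap.mk₂ k (fun h x => consTensor k H N s h (φ x))
      (fun g h x => consTensor_add g h _) (fun c h x => consTensor_smul c h _)
      (fun h x y => by rw [map_add, map_add]) (fun c h x => by rw [map_smul, map_smul]))
    (fun h hh => LinearMap.ext fun x => consTensor_of_mem hh _)
    (fun h l x => by rw [LinearMap.mk₂_apply, LinearMap.mk₂_apply, hφ, consTensor_mul_coe])

lemma tensorOneSucc_cons (φ : Bar k H s N →ₗ[k] BalTensor k H (Bar k H s H) N)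
    (hφ : ∀ l x, φ (l • x) = smulTensor k H N s l (φ x)) (h : H) (x : Bar k H s N) :
    tensorOneSucc φ hφ (cons h x) = consTensor k H N s h (φ x) := rfl

lemma tensorOneSucc_smul (φ : Bar k H s N →ₗ[k] BalTensor k H (Bar k H s H) N)
    (hφ : ∀ l x, φ (l • x) = smulTensor k H N s l (φ x)) (l : HL k H) (x : Bar k H (s + 1) N) :
    tensorOneSucc φ hφ (l • x) = smulTensor k H N (s + 1) l (tensorOneSucc φ hφ x) := by
  induction x using cons_induction with
  | zero => simp only [map_zero, smul_zero]
  | add x y hx hy => simp only [map_add, smul_add, hx, hy]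
  | cons h x => rw [smul_cons, tensorOneSucc_cons, tensorOneSucc_cons, smulTensor_consTensor]

variable (k H N) in
/-- The map `h₁ ⊗ ⋯ ⊗ hₛ ⊗ n ↦ (h₁ ⊗ ⋯ ⊗ hₛ ⊗ 1) ⊗ n`, with its `H^L`-linearity. -/
noncomputable def tensorOne : (s : ℕ) →
    {φ : Bar k H s N →ₗ[k] BalTensor k H (Bar k H s H) N //
      ∀ l x, φ (l • x) = smulTensor k H N s l (φ x)}
  | 0 => ⟨tensorOneZero k H N, tensorOneZero_smul⟩
  | s + 1 => ⟨tensorOneSucc (tensorOne s).1 (tensorOne s).2,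
      tensorOneSucc_smul (tensorOne s).1 (tensorOne s).2⟩

lemma tensorOne_tmul (h : Fin s → H) (n : N) :
    (tensorOne k H N s).1 (tmul k h n) = BalTensor.tmul k H (tmul k h (1 : H)) n := by
  induction s with
  | zero => rfl
  | succ s ih =>
    have h1 (x : Bar k H s N) : (tensorOne k H N (s + 1)).1 (cons (h 0) x) =
      consTensor k H N s (h 0) ((tensorOne k H N s).1 x) := rfl
    rw [tmul_succ, h1, ih, consTensor_tmul, ← tmul_succ]

variable (k H N s) in
/-- The isomorphism `(H̄^{⊗ s} ⊗_{H^L} H) ⊗_H N ≅ H̄^{⊗ s} ⊗_{H^L} N`. -/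
noncomputable def evalTensorEquiv : BalTensor k H (Bar k H s H) N ≃ₗ[k] Bar k H s N :=
  .ofLinearMap (evalTensor k H N s) (tensorOne k H N s).1
    (LinearMap.ext fun x => by
      rw [LinearMap.comp_apply, LinearMap.id_apply]
      induction x using Bar.induction_on with
      | zero => simp only [map_zero]
      | add x y hx hy => rw [map_add, map_add, hx, hy]
      | tmul h n => rw [tensorOne_tmul, evalTensor_tmul, one_smul])
    (BalTensor.hom_ext fun x n => by
      rw [LinearMap.comp_apply, LinearMap.id_apply]
      induction x using Bar.induction_on with
      | zero => simp only [map_zero, BalTensor.zero_tmul]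
      | add x y hx hy => rw [BalTensor.add_tmul, map_add, map_add, hx, hy]
      | tmul h a =>
        -- The relation over `H` moves `a` from `n` back to the final entry `1`.
        rw [evalTensor_tmul, tensorOne_tmul, ← BalTensor.smul_tmul, op_smul_tmul]
        congr 2
        exact one_mul a)

end TensorSelf

end Bar

/-! ### Homology -/

section TensorFunctor

variable {k H : Type u} [Field k] [Ring H] [Algebra k H]

/-- The value of `tensorFunctor` at a module `X` with a given vector space structure. -/
noncomputable def tensorFunctorEquiv (N : ModuleCat.{u} H) (M : ModuleCat.{u} Hᵐᵒᵖ)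
    {X : Type u} [AddCommGroup X] [Module k X] [Module Hᵐᵒᵖ X] [IsScalarTower k Hᵐᵒᵖ X]
    (e : M ≃ₗ[Hᵐᵒᵖ] X) : BalTensor k H M N ≃ₗ[k] BalTensor k H X N :=
  .ofLinearMap
    (BalTensor.map (e.toLinearMap.restrictScalars k) LinearMap.id
      (fun r m => e.map_smul (op r) m) (fun _ _ => rfl))
    (BalTensor.map (e.symm.toLinearMap.restrictScalars k) LinearMap.id
      (fun r m => e.symm.map_smul (op r) m) (fun _ _ => rfl))
    (BalTensor.hom_ext fun m n => congrArg (BalTensor.tmul k H · n) (e.apply_symm_apply m))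
    (BalTensor.hom_ext fun m n => congrArg (BalTensor.tmul k H · n) (e.symm_apply_apply m))

/-- The functor uses the `k`-structure restricted from `Hᵐᵒᵖ`, while the bar terms carry their own;
`e` and `e'` translate between the two. -/
lemma tensorFunctorEquiv_map_left (N : ModuleCat.{u} H) {M M' : ModuleCat.{u} Hᵐᵒᵖ}
    {X : Type u} [AddCommGroup X] [Module k X] [Module Hᵐᵒᵖ X] [IsScalarTower k Hᵐᵒᵖ X]
    {X' : Type u} [AddCommGroup X'] [Module k X'] [Module Hᵐᵒᵖ X'] [IsScalarTower k Hᵐᵒᵖ X']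
    (e : M ≃ₗ[Hᵐᵒᵖ] X) (e' : M' ≃ₗ[Hᵐᵒᵖ] X') (f : M ⟶ M') (g : X →ₗ[Hᵐᵒᵖ] X')
    (h : ∀ m, e' (f.hom m) = g (e m)) (t : BalTensor k H M N) :
    tensorFunctorEquiv (k := k) N M' e' (((tensorFunctor k H N).map f).hom t) =
      BalTensor.map (g.restrictScalars k) LinearMap.id (fun r m => g.map_smul (op r) m)
        (fun _ _ => rfl) (tensorFunctorEquiv (k := k) N M e t) := by
  induction t using BalTensor.induction_on with
  | zero =>
    exact (congrArg _ (map_zero _)).trans ((map_zero (tensorFunctorEquiv (k := k) N M' e')).trans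
      (by simp only [map_zero]))
  | add x y hx hy =>
    exact (congrArg _ (map_add _ x y)).trans ((map_add (tensorFunctorEquiv (k := k) N M' e') _ _).trans
      ((congrArg₂ (· + ·) hx hy).trans (by simp only [map_add])))
  | tmul m n => exact congrArg (BalTensor.tmul k H · n) (h m)

lemma tensorFunctorEquiv_map_right {N N' : ModuleCat.{u} H} (f : N ⟶ N') {M : ModuleCat.{u} Hᵐᵒᵖ}
    {X : Type u} [AddCommGroup X] [Module k X] [Module Hᵐᵒᵖ X] [IsScalarTower k Hᵐᵒᵖ X]
    (e : M ≃ₗ[Hᵐᵒᵖ] X) (t : BalTensor k H M N) :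
    tensorFunctorEquiv (k := k) N' M e (((tensorFunctorMap k f).app M).hom t) =
      BalTensor.map LinearMap.id (f.hom.restrictScalars k) (fun _ _ => rfl)
        (fun r n => f.hom.map_smul r n) (tensorFunctorEquiv (k := k) N M e t) := by
  induction t using BalTensor.induction_on with
  | zero =>
    exact (congrArg _ (map_zero _)).trans ((map_zero (tensorFunctorEquiv (k := k) N' M e)).trans
      (by simp only [map_zero]))
  | add x y hx hy =>
    exact (congrArg _ (map_add _ x y)).trans ((map_add (tensorFunctorEquiv (k := k) N' M e) _ _).trans
      ((congrArg₂ (· + ·) hx hy).trans (by simp only [map_add])))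
  | tmul m n => rfl

end TensorFunctor

section Homology

variable {k H : Type u} [Field k] [Ring H] [Algebra k H] [WeakHopfAlgebra k H]

variable (k) in
/-- The bar complex with coefficients in `N`. -/
noncomputable abbrev barChains (N : ModuleCat.{u} H) : ChainComplex (ModuleCat.{u} k) ℕ :=
  barComplex (k := k) (fun s => Bar.diff (k := k) N s)
    (fun s => LinearMap.ext fun x => Bar.diff_diff s x)

lemma barChains_d (N : ModuleCat.{u} H) (s : ℕ) :
    (barChains k N).d (s + 1) s = ModuleCat.ofHom (Bar.diff (k := k) N s) :=
  ChainComplex.of_d (fun s => ModuleCat.of k (Bar k H s N))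
    (fun s => ModuleCat.ofHom (Bar.diff (k := k) N s)) s

variable (k) in
/-- The terms of the bar complex of `N` as values of `- ⊗_H N`. -/
noncomputable def tensorBarEquiv (N : ModuleCat.{u} H) (s : ℕ) :
    (tensorFunctor k H N).obj (ModuleCat.of Hᵐᵒᵖ (Bar k H s H)) ≃ₗ[k] Bar k H s N :=
  tensorFunctorEquiv (k := k) N (ModuleCat.of Hᵐᵒᵖ (Bar k H s H)) (.refl Hᵐᵒᵖ (Bar k H s H)) ≪≫ₗ
    Bar.evalTensorEquiv k H N s

lemma tensorBarEquiv_diffH (N : ModuleCat.{u} H) (s : ℕ)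
    (t : (tensorFunctor k H N).obj (ModuleCat.of Hᵐᵒᵖ (Bar k H (s + 1) H))) :
    Bar.diff (k := k) N s (tensorBarEquiv k N (s + 1) t) =
      tensorBarEquiv k N s
        (((tensorFunctor k H N).map (ModuleCat.ofHom (Bar.diffH k H s))).hom t) :=
  (Bar.evalTensor_diffH (N := N) _).symm.trans
    (congrArg (Bar.evalTensor k H N s) (tensorFunctorEquiv_map_left N _ _
      (ModuleCat.ofHom (Bar.diffH k H s)) (Bar.diffH k H s) (fun _ => rfl) t).symm)

lemma tensorBarEquiv_map {N N' : ModuleCat.{u} H} (f : N ⟶ N') (s : ℕ)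
    (t : (tensorFunctor k H N).obj (ModuleCat.of Hᵐᵒᵖ (Bar k H s H))) :
    tensorBarEquiv k N' s (((tensorFunctorMap k f).app _).hom t) =
      Bar.mapHom f s (tensorBarEquiv k N s t) :=
  (congrArg (Bar.evalTensor k H N' s) (tensorFunctorEquiv_map_right f _ t)).trans
    (Bar.evalTensor_map f.hom _)

variable (k) in
/-- Tensoring the bar resolution over `H` with `N` gives the bar complex of `N`. -/
noncomputable def tensorBarIso (N : ModuleCat.{u} H) :
    ((tensorFunctor k H N).mapHomologicalComplex _).obj (barComplexH k H) ≅ barChains k N :=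
  HomologicalComplex.Hom.isoOfComponents
    (fun s => (tensorBarEquiv k N s).toModuleIso)
    (fun i j hij => by
      obtain rfl : j + 1 = i := hij
      rw [barChains_d]
      have h1 : (((tensorFunctor k H N).mapHomologicalComplex (ComplexShape.down ℕ)).obj
          (barComplexH k H)).d (j + 1) j =
          (tensorFunctor k H N).map (ModuleCat.ofHom (Bar.diffH k H j)) :=
        congrArg (tensorFunctor k H N).map (barComplexH_d k H j)
      rw [h1]
      exact ModuleCat.hom_ext (LinearMap.ext fun t => tensorBarEquiv_diffH N j t))

variable (k) in
/-- The homology of the bar complex of `N` is the homology of `H` with coefficients in `N`. -/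
noncomputable def barHomologyIso (N : ModuleCat.{u} H) (n : ℕ) :
    (barChains k N).homology n ≅ homology k H N n :=
  ((HomologicalComplex.homologyFunctor _ _ n).mapIso (tensorBarIso k N)).symm ≪≫
    ((barResolution k H).isoLeftDerivedObj (tensorFunctor k H N) n).symm

lemma diff_mapHom {N N' : ModuleCat.{u} H} (f : N ⟶ N') (s : ℕ) :
    Bar.diff (k := k) N' s ∘ₗ Bar.mapHom f (s + 1) = Bar.mapHom f s ∘ₗ Bar.diff (k := k) N s :=
  LinearMap.ext fun x => Bar.diff_map (f.hom.restrictScalars (HL k H))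
    (fun h n => f.hom.map_smul h n) s x

/-- The map of bar complexes induced by a map of left `H`-modules. -/
noncomputable abbrev barChainsMap {N N' : ModuleCat.{u} H} (f : N ⟶ N') :
    barChains k N ⟶ barChains k N' :=
  barComplexMap f (fun s => LinearMap.ext fun x => Bar.diff_diff s x)
    (fun s => LinearMap.ext fun x => Bar.diff_diff s x) (diff_mapHom f)

lemma tensorBarIso_naturality {N N' : ModuleCat.{u} H} (f : N ⟶ N') :
    (NatTrans.mapHomologicalComplex (tensorFunctorMap k f) _).app (barComplexH k H) ≫
      (tensorBarIso k N').hom = (tensorBarIso k N).hom ≫ barChainsMap f :=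
  HomologicalComplex.hom_ext _ _ fun s => ModuleCat.hom_ext (LinearMap.ext fun t =>
    tensorBarEquiv_map f s t)

lemma comp_symm_trans_symm_hom {C : Type*} [Category* C] {X X' Y Y' Z Z' : C} {i : Y ≅ X}
    {i' : Y' ≅ X'} {j : Z ≅ Y} {j' : Z' ≅ Y'} {f : X ⟶ X'} {g : Y ⟶ Y'} {h : Z ⟶ Z'}
    (hg : g ≫ i'.hom = i.hom ≫ f) (hh : h = j.hom ≫ g ≫ j'.inv) :
    f ≫ (i'.symm ≪≫ j'.symm).hom = (i.symm ≪≫ j.symm).hom ≫ h := by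
  have h1 : f = i.inv ≫ g ≫ i'.hom := by rw [hg, Iso.inv_hom_id_assoc]
  simp [h1, hh]

/-- Two squares are pasted: homology applied to the naturality of `tensorBarIso`, and the
computation of a derived natural transformation on a fixed resolution. -/
lemma barHomologyIso_naturality {N N' : ModuleCat.{u} H} (f : N ⟶ N') (n : ℕ) :
    HomologicalComplex.homologyMap (barChainsMap (k := k) f) n ≫ (barHomologyIso k N' n).hom =
      (barHomologyIso k N n).hom ≫ homologyMap k f n := by
  have h1 := congrArg (HomologicalComplex.homologyFunctor _ _ n).map
    (tensorBarIso_naturality (k := k) f)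
  rw [Functor.map_comp, Functor.map_comp] at h1
  exact comp_symm_trans_symm_hom h1
    (ProjectiveResolution.leftDerived_app_eq (tensorFunctorMap k f) (barResolution k H) n)

end Homology

end WeakHopf

/-! ### The cohomology of a complex of modules, by cocycles modulo coboundaries -/

section CocycleQuotient

variable {R : Type u} [Ring R] (K : CochainComplex (ModuleCat.{u} R) ℕ) (n : ℕ)
  {E : Type u} [AddCommGroup E] [Module R E]

namespace CochainComplex

/-- The submodule of cocycles. -/
noncomputable def cocycles : Submodule R (K.X n) := LinearMap.ker (K.d n (n + 1)).hom

lemma mem_ker_sc_g (x : K.X n) : (K.sc n).g.hom x = 0 ↔ x ∈ cocycles K n := by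
  -- The short complex `K.sc n` ends at the abstract successor of `n`, whose equality with `n + 1`
  -- must be eliminated as a variable.
  have h (m : ℕ) (hm : m = n + 1) : (K.d n m).hom x = 0 ↔ x ∈ cocycles K n := by
    subst hm; exact Iff.rfl
  exact h _ (CochainComplex.next ℕ n)

/-- The kernel in `K.sc n` consists of the cocycles. -/
noncomputable def kerEquivCocycles : LinearMap.ker (K.sc n).g.hom ≃ₗ[R] cocycles K n where
  toFun z := ⟨z.1, (mem_ker_sc_g K n z.1).1 z.2⟩
  invFun z := ⟨z.1, (mem_ker_sc_g K n z.1).2 z.2⟩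
  map_add' _ _ := rfl
  map_smul' _ _ := rfl

variable {K n}

variable (Φ : cocycles K n →ₗ[R] E) (hΦ : Function.Surjective Φ)
  (hker : ∀ z, Φ z = 0 ↔ ∃ y, (K.d ((ComplexShape.up ℕ).prev n) n).hom y = z.1)

/-- The quotient of the cocycles by the coboundaries is the target of any surjection from the
cocycles whose kernel consists of the coboundaries. -/
noncomputable def quotientEquivOfCocycles : (K.sc n).moduleCatLeftHomologyData.H ≃ₗ[R] E :=
  (Submodule.quotEquivOfEq _ (LinearMap.ker (Φ ∘ₗ (kerEquivCocycles K n).toLinearMap)) (by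
    ext z
    refine Iff.trans ?_ (hker (kerEquivCocycles K n z)).symm
    exact ⟨fun ⟨y, hy⟩ => ⟨y, congrArg Subtype.val hy⟩, fun ⟨y, hy⟩ => ⟨y, Subtype.ext hy⟩⟩)) ≪≫ₗ
  LinearMap.quotKerEquivOfSurjective (Φ ∘ₗ (kerEquivCocycles K n).toLinearMap)
    (hΦ.comp (LinearEquiv.surjective _))

/-- The homology of a cochain complex in degree `n` is the target of any surjection from the
cocycles whose kernel consists of the coboundaries. -/
noncomputable def homologyIsoOfCocycles : K.homology n ≅ ModuleCat.of R E :=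
  (K.sc n).moduleCatHomologyIso ≪≫ (quotientEquivOfCocycles Φ hΦ hker).toModuleIso

lemma iCycles_mem_cocycles (x : K.cycles n) :
    (K.iCycles n).hom x ∈ cocycles K n :=
  LinearMap.congr_fun (congrArg ModuleCat.Hom.hom (K.iCycles_d n (n + 1))) x

lemma homologyIsoOfCocycles_homologyπ (x : K.cycles n) :
    (homologyIsoOfCocycles Φ hΦ hker).hom.hom ((K.homologyπ n).hom x) =
      Φ ⟨(K.iCycles n).hom x, iCycles_mem_cocycles x⟩ := by
  have h1 := LinearMap.congr_fun (congrArg ModuleCat.Hom.hom (K.sc n).π_moduleCatCyclesIso_hom) x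
  have h2 := LinearMap.congr_fun (congrArg ModuleCat.Hom.hom (K.sc n).moduleCatCyclesIso_hom_i) x
  refine (congrArg (quotientEquivOfCocycles Φ hΦ hker) h1).trans ?_
  exact congrArg Φ (Subtype.ext h2)

/-- Cycles map onto homology, so the square need only be compared on representing cocycles. -/
lemma homologyIsoOfCocycles_naturality {K' : CochainComplex (ModuleCat.{u} R) ℕ} {E' : Type u}
    [AddCommGroup E'] [Module R E'] (Φ' : cocycles K' n →ₗ[R] E')
    (hΦ' : Function.Surjective Φ')
    (hker' : ∀ z, Φ' z = 0 ↔ ∃ y, (K'.d ((ComplexShape.up ℕ).prev n) n).hom y = z.1)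
    (f : K ⟶ K') (g : E →ₗ[R] E')
    (h : ∀ z z', (f.f n).hom z.1 = z'.1 → Φ' z' = g (Φ z)) :
    HomologicalComplex.homologyMap f n ≫ (homologyIsoOfCocycles Φ' hΦ' hker').hom =
      (homologyIsoOfCocycles Φ hΦ hker).hom ≫ ModuleCat.ofHom g := by
  rw [← cancel_epi (K.homologyπ n), HomologicalComplex.homologyπ_naturality_assoc]
  ext x
  refine (homologyIsoOfCocycles_homologyπ Φ' hΦ' hker' _).trans ?_
  refine Eq.trans ?_ (congrArg g (homologyIsoOfCocycles_homologyπ Φ hΦ hker x)).symm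
  exact h _ _ (LinearMap.congr_fun (congrArg ModuleCat.Hom.hom
    (HomologicalComplex.cyclesMap_i f n)) x).symm

end CochainComplex

end CocycleQuotient

/-! ### The group `Ext` of a projective resolution in degree `0` -/

namespace CategoryTheory.ProjectiveResolution

open CochainComplex HomComplex Abelian

/-- In degree `0` there are no nonzero coboundaries. Indexed cohomologically, the resolution lives
in degrees `≤ 0`, so a coboundary factors through a differential into degree `1`, which vanishes. -/
lemma extMk_zero_eq_zero_iff {C : Type*} [Category* C] [Abelian C] [HasExt.{u} C] {X Y : C}
    (R : ProjectiveResolution X) (f : R.complex.X 0 ⟶ Y) (hf : R.complex.d 1 0 ≫ f = 0) :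
    R.extMk f 1 rfl hf = 0 ↔ f = 0 := by
  refine ⟨fun h => ?_, fun h => by subst h; exact R.extMk_zero 1 rfl⟩
  rw [← R.extEquivCohomologyClass.apply_eq_iff_eq, extEquivCohomologyClass_extMk,
    extEquivCohomologyClass_zero, CohomologyClass.mk_eq_zero_iff,
    Cocycle.toSingleMk_mem_coboundaries_iff _ _ _ _ _ 1 (by simp)] at h
  obtain ⟨g, hg⟩ := h
  have h0 : R.cochainComplex.d (-((0 : ℕ) : ℤ)) 1 = 0 :=
    (R.cochainComplex.isZero_of_isStrictlyLE 0 1 (by simp)).eq_of_tgt _ _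
  rw [h0, Limits.zero_comp] at hg
  rw [← cancel_epi (R.cochainComplexXIso (-((0 : ℕ) : ℤ)) 0 rfl).hom, ← hg, Limits.comp_zero]

end CategoryTheory.ProjectiveResolution

namespace WeakHopf

/-! ### Cochains as right `H`-linear maps on the bar complex -/

section Cochain

variable {k H : Type u} [Field k] [Ring H] [Algebra k H] [WeakHopfAlgebra k H]
variable {N : Type u} [AddCommGroup N] [Module k N] [Module Hᵐᵒᵖ N] [IsScalarTower k Hᵐᵒᵖ N]

lemma Bar.hom_ext_tmul_one {s : ℕ} {N : Type u} [AddCommGroup N] [Module Hᵐᵒᵖ N] {f g : Bar k H s H →ₗ[Hᵐᵒᵖ] N}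
    (h : ∀ h, f (Bar.tmul k h 1) = g (Bar.tmul k h 1)) : f = g := by
  ext x
  induction x using Bar.induction_on with
  | zero => rw [map_zero, map_zero]
  | add x y hx hy => rw [map_add, map_add, hx, hy]
  | tmul v a =>
    have h1 : Bar.tmul k v a = op a • Bar.tmul k v (1 : H) := by
      rw [Bar.op_smul_tmul]
      exact congrArg (Bar.tmul k v) (one_mul a).symm
    rw [h1, map_smul, map_smul, h]

namespace Cochain

/-- The right `H`-linear map on the bar complex given by a cochain. -/
noncomputable def toHom : {s : ℕ} → Cochain k H N s → (Bar k H s H →ₗ[Hᵐᵒᵖ] N)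
  | 0, n =>
    { toFun := fun (a : H) => op a • (show N from n)
      map_add' := fun (a b : H) => add_smul (op a) (op b) (show N from n)
      map_smul' := fun a (b : H) => mul_smul a (op b) (show N from n) }
  | _ + 1, b => Bar.extend (show HomHL k H N _ from b)

lemma toHom_tmul {s : ℕ} (c : Cochain k H N s) (h : Fin s → H) :
    c.toHom (Bar.tmul k h 1) = c.eval h := by
  cases s with
  | zero => exact one_smul Hᵐᵒᵖ (show N from c)
  | succ s => exact (congrArg _ (Bar.insertOne_tmul h)).symm.trans (Bar.extend_insertOne _ _)

lemma eval_add {s : ℕ} (b c : Cochain k H N s) (h : Fin s → H) :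
    (b + c).eval h = b.eval h + c.eval h := by
  cases s <;> rfl

lemma eval_smul {s : ℕ} (r : k) (c : Cochain k H N s) (h : Fin s → H) :
    (r • c).eval h = r • c.eval h := by
  cases s <;> rfl

/-- The cochain given by a right `H`-linear map on the bar complex. -/
noncomputable def ofHom : {s : ℕ} → (Bar k H s H →ₗ[Hᵐᵒᵖ] N) → Cochain k H N s
  | 0, f => f (Bar.tmul k Fin.elim0 1)
  | s + 1, f => (⟨f.restrictScalars k ∘ₗ (Bar.insertOne k H s).restrictScalars k, fun l x => by
      refine (congrArg f (Bar.insertOne_op_smul l x)).trans (map_smul f _ _)⟩ : HomHL k H N s)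

lemma eval_ofHom {s : ℕ} (f : Bar k H s H →ₗ[Hᵐᵒᵖ] N) (h : Fin s → H) :
    (ofHom f).eval h = f (Bar.tmul k h 1) := by
  cases s with
  | zero => rfl
  | succ s => exact congrArg f (Bar.insertOne_tmul h)

/-- In positive degree the values on pure tensors determine the `H`-linear extension, since tensors
ending in `1` generate; the extension restricts back to the cochain. -/
lemma ext_eval {s : ℕ} {b c : Cochain k H N s} (h : ∀ h, b.eval h = c.eval h) : b = c := by
  cases s with
  | zero => exact h Fin.elim0
  | succ s =>
    refine Subtype.ext (LinearMap.ext fun y => ?_)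
    have h1 : toHom b = toHom c := Bar.hom_ext_tmul_one fun v => by
      rw [toHom_tmul, toHom_tmul, h]
    exact (Bar.extend_insertOne _ _).symm.trans ((congrArg (fun f : Bar k H (s + 1) H →ₗ[Hᵐᵒᵖ] N =>
      f (Bar.insertOne k H s y)) h1).trans (Bar.extend_insertOne _ _))

lemma toHom_ofHom {s : ℕ} (f : Bar k H s H →ₗ[Hᵐᵒᵖ] N) : toHom (ofHom f) = f :=
  Bar.hom_ext_tmul_one fun h => by rw [toHom_tmul, eval_ofHom]

lemma ofHom_toHom {s : ℕ} (c : Cochain k H N s) : ofHom c.toHom = c :=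
  ext_eval fun h => by rw [eval_ofHom, toHom_tmul]

lemma toHom_add {s : ℕ} (b c : Cochain k H N s) : (b + c).toHom = b.toHom + c.toHom :=
  Bar.hom_ext_tmul_one fun h => by
    rw [LinearMap.add_apply, toHom_tmul, toHom_tmul, toHom_tmul, eval_add]

lemma toHom_smul {s : ℕ} (r : k) (c : Cochain k H N s) : (r • c).toHom = r • c.toHom :=
  Bar.hom_ext_tmul_one fun h => by
    rw [LinearMap.smul_apply, toHom_tmul, toHom_tmul, eval_smul]

variable (k H N) in
/-- The differential of the cobar complex. -/
noncomputable def diff (s : ℕ) : Cochain k H N s →ₗ[k] Cochain k H N (s + 1) where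
  toFun c := ofHom (c.toHom ∘ₗ Bar.diffH k H s)
  map_add' b c := ext_eval fun h => by
    rw [eval_add, eval_ofHom, eval_ofHom, eval_ofHom, toHom_add]; rfl
  map_smul' r c := ext_eval fun h => by
    rw [RingHom.id_apply, eval_smul, eval_ofHom, eval_ofHom, toHom_smul]; rfl

/-- Under the correspondence with `H`-linear maps the codifferential is precomposition with `d'`, so
cocycles and coboundaries match those of the bar resolution. -/
lemma toHom_diff {s : ℕ} (c : Cochain k H N s) :
    (diff k H N s c).toHom = c.toHom ∘ₗ Bar.diffH k H s := toHom_ofHom _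

lemma eval_diff {s : ℕ} (c : Cochain k H N s) (h : Fin (s + 1) → H) :
    (diff k H N s c).eval h = c.toHom (Bar.diffH k H s (Bar.tmul k h 1)) := eval_ofHom _ _

lemma diff_comp_diff (s : ℕ) : diff k H N (s + 1) ∘ₗ diff k H N s = 0 := by
  refine LinearMap.ext fun c => ext_eval fun h => ?_
  refine (eval_diff _ _).trans ?_
  rw [toHom_diff, LinearMap.comp_apply, Bar.diffH_diffH, map_zero]
  cases s <;> rfl

lemma toHom_zero {s : ℕ} : (0 : Cochain k H N s).toHom = 0 := by
  simpa using toHom_smul (0 : k) (0 : Cochain k H N s)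

lemma diff_eq_zero_iff {s : ℕ} (c : Cochain k H N s) :
    diff k H N s c = 0 ↔ c.toHom ∘ₗ Bar.diffH k H s = 0 := by
  rw [← toHom_diff]
  refine ⟨fun h => by rw [h, toHom_zero], fun h => ?_⟩
  rw [← ofHom_toHom (diff k H N s c), h, ← toHom_zero, ofHom_toHom]

variable (k H N) in
lemma isBarCodifferential : IsBarCodifferential (k := k) (H := H) (N := N)
    (fun s => diff k H N s) := by
  -- In the bar formula with coefficient `1`, the last summand ends in `hₛ·1`; by right linearity
  -- this `hₛ` becomes the right action on the value.
  have hone (s : ℕ) (c : Cochain k H N s) (h : Fin s → H) (a : H) :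
      c.toHom (Bar.tmul k h a) = op a • c.eval h := by
    rw [← toHom_tmul, ← map_smul, Bar.op_smul_tmul]
    exact congrArg (fun a : H => c.toHom (Bar.tmul k h a)) (one_mul a).symm
  constructor
  · intro c h
    refine (eval_diff c h).trans ?_
    have h1 := (Bar.isBarDifferential (k := k) (H := H) H).1 h 1
    refine (congrArg c.toHom h1).trans ?_
    rw [hone, smul_eq_mul, smul_eq_mul, mul_one, mul_one, MulOpposite.op_sub, sub_smul]
  · intro s c h
    refine (eval_diff c h).trans ?_
    have h1 := (Bar.isBarDifferential (k := k) (H := H) H).2 s h 1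
    refine (congrArg c.toHom h1).trans ?_
    rw [map_add, map_add, map_sum, map_zsmul, hone, hone, smul_eq_mul, mul_one, op_one, one_smul]
    simp only [map_zsmul, toHom_tmul]

end Cochain

end Cochain

/-! ### Naturality of the codifferential -/

section Naturality

variable {k H : Type u} [Field k] [Ring H] [Algebra k H] [WeakHopfAlgebra k H]
variable {N N' : ModuleCat.{u} Hᵐᵒᵖ} (f : N ⟶ N')

namespace Cochain

lemma eval_map {s : ℕ} (c : Cochain k H N s) (h : Fin s → H) :
    (map f s c).eval h = f.hom (c.eval h) := by
  cases s <;> rfl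

lemma toHom_map {s : ℕ} (c : Cochain k H N s) : (map f s c).toHom = f.hom ∘ₗ c.toHom :=
  Bar.hom_ext_tmul_one fun h => by
    rw [LinearMap.comp_apply, toHom_tmul, toHom_tmul, eval_map]

variable (k) in
lemma diff_comp_map (s : ℕ) :
    diff k H N' s ∘ₗ map f s = map f (s + 1) ∘ₗ diff k H N s :=
  LinearMap.ext fun c => ext_eval fun h => by
    rw [LinearMap.comp_apply, LinearMap.comp_apply, eval_map, eval_diff, eval_diff, toHom_map]
    rfl

end Cochain

end Naturality

/-! ### Cohomology -/

section Cohomology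

variable {k H : Type u} [Field k] [Ring H] [Algebra k H] [WeakHopfAlgebra k H]

variable (k) in
/-- The cobar complex with coefficients in `N`. -/
noncomputable abbrev barCochains (N : ModuleCat.{u} Hᵐᵒᵖ) : CochainComplex (ModuleCat.{u} k) ℕ :=
  cobarComplex (k := k) (fun s => Cochain.diff k H N s) (Cochain.diff_comp_diff (N := N))

lemma barCochains_d (N : ModuleCat.{u} Hᵐᵒᵖ) (s : ℕ) :
    (barCochains k N).d s (s + 1) = ModuleCat.ofHom (Cochain.diff k H N s) :=
  CochainComplex.of_d (fun s => ModuleCat.of k (Cochain k H N s))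
    (fun s => ModuleCat.ofHom (Cochain.diff k H N s)) s

variable {N : ModuleCat.{u} Hᵐᵒᵖ} {n : ℕ}

lemma mem_cocycles_iff (c : Cochain k H N n) :
    (show (barCochains k N).X n from c) ∈ (barCochains k N).cocycles n ↔
      Cochain.diff k H N n c = 0 := by
  change ((barCochains k N).d n (n + 1)).hom c = 0 ↔ _
  rw [barCochains_d]
  exact Iff.rfl

lemma d_comp_ofHom_toHom (c : Cochain k H N n) (hc : Cochain.diff k H N n c = 0) :
    (barResolution k H).complex.d (n + 1) n ≫ ModuleCat.ofHom c.toHom = 0 := by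
  have h1 : (barResolution k H).complex.d (n + 1) n = ModuleCat.ofHom (Bar.diffH k H n) :=
    barComplexH_d k H n
  rw [h1]
  exact congrArg ModuleCat.ofHom ((Cochain.diff_eq_zero_iff c).1 hc)

/-- The cohomology class of a cocycle. -/
noncomputable def cocycleClass (c : Cochain k H N n) (hc : Cochain.diff k H N n c = 0) :
    cohomology k H N n :=
  (barResolution k H).extMk (ModuleCat.ofHom c.toHom) (n + 1) rfl (d_comp_ofHom_toHom c hc)

lemma cocycleClass_add (b c : Cochain k H N n) (hb : Cochain.diff k H N n b = 0)
    (hc : Cochain.diff k H N n c = 0) (hbc : Cochain.diff k H N n (b + c) = 0) :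
    cocycleClass (b + c) hbc = cocycleClass b hb + cocycleClass c hc := by
  refine Eq.trans ?_ ((barResolution k H).add_extMk _ _ _ rfl _ _).symm
  rw [cocycleClass]
  congr 1
  exact congrArg ModuleCat.ofHom (Cochain.toHom_add b c)

lemma cocycleClass_map {N' : ModuleCat.{u} Hᵐᵒᵖ} (f : N ⟶ N') (c : Cochain k H N n)
    (hc : Cochain.diff k H N n c = 0) (hc' : Cochain.diff k H N' n (Cochain.map f n c) = 0) :
    cocycleClass (Cochain.map f n c) hc' = cohomologyMap f n (cocycleClass c hc) := by
  refine Eq.trans ?_ ((barResolution k H).extMk_comp_mk₀ _ _ rfl _ f).symm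
  rw [cocycleClass]
  congr 1
  exact congrArg ModuleCat.ofHom (Cochain.toHom_map f c)

lemma cocycleClass_smul (r : k) (c : Cochain k H N n) (hc : Cochain.diff k H N n c = 0)
    (hrc : Cochain.diff k H N n (r • c) = 0) :
    cocycleClass (r • c) hrc = r • cocycleClass c hc := by
  -- The scalar action on `Ext` is composition with `r` times the identity of `N`, so it is treated
  -- like a coefficient map.
  rw [Abelian.Ext.smul_eq_comp_mk₀]
  refine Eq.trans ?_ ((barResolution k H).extMk_comp_mk₀ _ _ rfl _ _).symm
  rw [cocycleClass]
  congr 1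
  exact congrArg ModuleCat.ofHom (Cochain.toHom_smul r c)

lemma exists_cocycleClass (x : cohomology k H N n) :
    ∃ (c : Cochain k H N n) (hc : Cochain.diff k H N n c = 0), cocycleClass c hc = x := by
  obtain ⟨f, hf, rfl⟩ := (barResolution k H).extMk_surjective x (n + 1) rfl
  have h1 : (barResolution k H).complex.d (n + 1) n = ModuleCat.ofHom (Bar.diffH k H n) :=
    barComplexH_d k H n
  let g : Bar k H n H →ₗ[Hᵐᵒᵖ] N := f.hom
  have h2 : (Cochain.ofHom g).toHom = g := Cochain.toHom_ofHom g
  have hc : Cochain.diff k H N n (Cochain.ofHom g) = 0 := by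
    rw [Cochain.diff_eq_zero_iff, h2]
    rw [h1] at hf
    exact congrArg ModuleCat.Hom.hom hf
  refine ⟨Cochain.ofHom g, hc, ?_⟩
  rw [cocycleClass]
  congr 1
  exact congrArg ModuleCat.ofHom h2

lemma cocycleClass_zero_eq_zero_iff (c : Cochain k H N 0) (hc : Cochain.diff k H N 0 c = 0) :
    cocycleClass c hc = 0 ↔ c = 0 := by
  refine ((barResolution k H).extMk_zero_eq_zero_iff _ _).trans ⟨fun h => ?_, fun h => ?_⟩
  · have h1 : c.toHom = 0 := congrArg ModuleCat.Hom.hom h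
    rw [← Cochain.ofHom_toHom c, h1, ← Cochain.toHom_zero, Cochain.ofHom_toHom]
  · subst h
    exact congrArg ModuleCat.ofHom Cochain.toHom_zero

/-- A class computed on the resolution vanishes exactly when its representing map factors through
the preceding differential; via `ofHom` such a factorization is a cochain bounding `c`. -/
lemma cocycleClass_succ_eq_zero_iff (c : Cochain k H N (n + 1))
    (hc : Cochain.diff k H N (n + 1) c = 0) :
    cocycleClass c hc = 0 ↔ ∃ b, Cochain.diff k H N n b = c := by
  have h1 : (barResolution k H).complex.d (n + 1) n = ModuleCat.ofHom (Bar.diffH k H n) :=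
    barComplexH_d k H n
  refine ((barResolution k H).extMk_eq_zero_iff _ _ rfl _ n rfl).trans ⟨?_, ?_⟩
  · rintro ⟨g, hg⟩
    rw [h1] at hg
    let g' : Bar k H n H →ₗ[Hᵐᵒᵖ] N := g.hom
    have h2 : (Cochain.ofHom g').toHom ∘ₗ Bar.diffH k H n = c.toHom := by
      rw [Cochain.toHom_ofHom]
      exact congrArg ModuleCat.Hom.hom hg
    refine ⟨Cochain.ofHom g', ?_⟩
    rw [← Cochain.ofHom_toHom c, ← h2]
    rfl
  · rintro ⟨b, rfl⟩
    refine ⟨ModuleCat.ofHom b.toHom, ?_⟩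
    rw [h1]
    exact congrArg ModuleCat.ofHom (Cochain.toHom_diff b).symm

variable (k N n) in
/-- The map from cocycles to cohomology. -/
noncomputable def cocycleClassₗ : (barCochains k N).cocycles n →ₗ[k] cohomology k H N n where
  toFun z := cocycleClass (show Cochain k H N n from z.1) ((mem_cocycles_iff _).1 z.2)
  map_add' _ _ := cocycleClass_add _ _ _ _ _
  map_smul' _ _ := cocycleClass_smul _ _ _ _

lemma cocycleClassₗ_surjective : Function.Surjective (cocycleClassₗ k N n) := fun x => by
  obtain ⟨c, hc, rfl⟩ := exists_cocycleClass x
  exact ⟨⟨c, (mem_cocycles_iff c).2 hc⟩, rfl⟩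

lemma cocycleClassₗ_eq_zero_iff (z : (barCochains k N).cocycles n) :
    cocycleClassₗ k N n z = 0 ↔
      ∃ y, ((barCochains k N).d ((ComplexShape.up ℕ).prev n) n).hom y = z.1 := by
  cases n with
  | zero =>
    refine (cocycleClass_zero_eq_zero_iff _ ((mem_cocycles_iff _).1 z.2)).trans ?_
    -- In degree `0` the predecessor index is a default value and the differential from it is zero,
    -- so the condition reads `z = 0`.
    rw [(barCochains k N).shape _ _ (by simp)]
    exact ⟨fun h => ⟨0, h.symm⟩, fun ⟨_, h⟩ => h.symm⟩
  | succ n =>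
    refine (cocycleClass_succ_eq_zero_iff _ ((mem_cocycles_iff _).1 z.2)).trans ?_
    rw [CochainComplex.prev_nat_succ, barCochains_d]
    exact Iff.rfl

variable (k) in
/-- The cohomology of the cobar complex of `N` is the cohomology of `H` with coefficients
in `N`. -/
noncomputable def barCohomologyIso (N : ModuleCat.{u} Hᵐᵒᵖ) (n : ℕ) :
    (barCochains k N).homology n ≅ ModuleCat.of k (cohomology k H N n) :=
  CochainComplex.homologyIsoOfCocycles (cocycleClassₗ k N n) cocycleClassₗ_surjective
    cocycleClassₗ_eq_zero_iff

/-- The map of cobar complexes induced by a map of right `H`-modules. -/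
noncomputable abbrev barCochainsMap {N N' : ModuleCat.{u} Hᵐᵒᵖ} (f : N ⟶ N') :
    barCochains k N ⟶ barCochains k N' :=
  cobarComplexMap f (Cochain.diff_comp_diff (N := N)) (Cochain.diff_comp_diff (N := N'))
    (Cochain.diff_comp_map k f)

/-- On cocycles this is `cocycleClass_map`: postcomposing a representing map with `f` is the Yoneda
product of its class with `f`. -/
lemma barCohomologyIso_naturality {N N' : ModuleCat.{u} Hᵐᵒᵖ} (f : N ⟶ N') (n : ℕ) :
    HomologicalComplex.homologyMap (barCochainsMap (k := k) f) n ≫ (barCohomologyIso k N' n).hom =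
      (barCohomologyIso k N n).hom ≫ ModuleCat.ofHom (cohomologyMap f n) :=
  CochainComplex.homologyIsoOfCocycles_naturality _ _ _ _ _ _ _ _ fun z z' h => by
    obtain ⟨z', hz'⟩ := z'
    subst h
    exact cocycleClass_map f _ ((mem_cocycles_iff _).1 z.2) ((mem_cocycles_iff _).1 hz')

end Cohomology

end WeakHopf
theorem proposition1p9 {k H : Type u} [Field k] [Ring H] [Algebra k H] [WeakHopfAlgebra k H] :
    -- the bar complex of right `H`-modules
    (∃ d : ∀ s : ℕ, WeakHopf.Bar k H (s + 1) H →ₗ[Hᵐᵒᵖ] WeakHopf.Bar k H s H,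
      WeakHopf.IsBarDifferential (k := k) (fun s => d s) ∧
      -- it is a complex
      (WeakHopf.augmentation k H ∘ₗ d 0 = 0 ∧ ∀ s, d s ∘ₗ d (s + 1) = 0) ∧
      -- it is contractible as a complex of right `H^L`-modules
      (∃ (h₀ : WeakHopf.HR k H →ₗ[k] WeakHopf.Bar k H 0 H)
          (h : ∀ s : ℕ, WeakHopf.Bar k H s H →ₗ[k] WeakHopf.Bar k H (s + 1) H),
        (∀ (l : WeakHopf.HL k H) y, h₀ (op (l : H) • y) = op (l : H) • h₀ y) ∧
        (∀ s (l : WeakHopf.HL k H) x, h s (op (l : H) • x) = op (l : H) • h s x) ∧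
        (∀ y, WeakHopf.augmentation k H (h₀ y) = y) ∧
        (∀ x, h₀ (WeakHopf.augmentation k H x) + d 0 (h 0 x) = x) ∧
        (∀ s x, h s (d s x) + d (s + 1) (h (s + 1) x) = x)) ∧
      -- it is a projective resolution of `H^R`
      (∀ s, Module.Projective Hᵐᵒᵖ (WeakHopf.Bar k H s H)) ∧
      (Function.Surjective (WeakHopf.augmentation k H) ∧
        Function.Exact (d 0) (WeakHopf.augmentation k H) ∧
        ∀ s, Function.Exact (d (s + 1)) (d s))) ∧
    -- homology, naturally in the left `H`-module `N`
    (∃ (d : ∀ (N : ModuleCat.{u} H) (s : ℕ),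
          WeakHopf.Bar k H (s + 1) N →ₗ[k] WeakHopf.Bar k H s N)
        (hd : ∀ N s, d N s ∘ₗ d N (s + 1) = 0)
        (e : ∀ N n, (WeakHopf.barComplex (d N) (hd N)).homology n ≅ WeakHopf.homology k H N n),
      (∀ N : ModuleCat.{u} H, WeakHopf.IsBarDifferential (k := k) (H := H) (N := (N : Type u))
        (fun s => d N s)) ∧
      ∀ (N N' : ModuleCat.{u} H) (f : N ⟶ N'),
        ∃ hf : ∀ s, d N' s ∘ₗ WeakHopf.Bar.mapHom f (s + 1) = WeakHopf.Bar.mapHom f s ∘ₗ d N s,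
          ∀ n, HomologicalComplex.homologyMap
              (WeakHopf.barComplexMap f (hd N) (hd N') hf) n ≫ (e N' n).hom =
            (e N n).hom ≫ WeakHopf.homologyMap k f n) ∧
    -- cohomology, naturally in the right `H`-module `N`
    (∃ (d : ∀ (N : ModuleCat.{u} Hᵐᵒᵖ) (s : ℕ),
          WeakHopf.Cochain k H N s →ₗ[k] WeakHopf.Cochain k H N (s + 1))
        (hd : ∀ N s, d N (s + 1) ∘ₗ d N s = 0)
        (e : ∀ N n, (WeakHopf.cobarComplex (d N) (hd N)).homology n ≅
          ModuleCat.of k (WeakHopf.cohomology k H N n)),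
      (∀ N : ModuleCat.{u} Hᵐᵒᵖ, WeakHopf.IsBarCodifferential (k := k) (H := H) (N := (N : Type u))
        (fun s => d N s)) ∧
      ∀ (N N' : ModuleCat.{u} Hᵐᵒᵖ) (f : N ⟶ N'),
        ∃ hf : ∀ s, d N' s ∘ₗ WeakHopf.Cochain.map f s = WeakHopf.Cochain.map f (s + 1) ∘ₗ d N s,
          ∀ n, HomologicalComplex.homologyMap
              (WeakHopf.cobarComplexMap f (hd N) (hd N') hf) n ≫ (e N' n).hom =
            (e N n).hom ≫ ModuleCat.ofHom (WeakHopf.cohomologyMap f n)) := by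
  refine ⟨⟨WeakHopf.Bar.diffH k H, WeakHopf.Bar.isBarDifferential H,
      ⟨LinearMap.ext WeakHopf.Bar.augmentation_diffH,
        fun s => LinearMap.ext (WeakHopf.Bar.diffH_diffH s)⟩,
      ⟨WeakHopf.Bar.augmentationSection k H,
        fun s => (WeakHopf.Bar.homotopy s).restrictScalars k,
        WeakHopf.Bar.augmentationSection_op_smul, WeakHopf.Bar.homotopy_op_smul,
        WeakHopf.Bar.augmentation_section, WeakHopf.Bar.section_augmentation,
        WeakHopf.Bar.homotopy_diff⟩,
      fun s => WeakHopf.Bar.projective s, WeakHopf.Bar.augmentation_surjective k H,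
      WeakHopf.Bar.exact_augmentation k H, WeakHopf.Bar.exact_diffH k H⟩,
    ⟨fun N s => WeakHopf.Bar.diff (k := k) N s,
      fun N s => LinearMap.ext fun x => WeakHopf.Bar.diff_diff s x,
      WeakHopf.barHomologyIso k, fun N => WeakHopf.Bar.isBarDifferential N,
      fun N N' f => ⟨WeakHopf.diff_mapHom f, WeakHopf.barHomologyIso_naturality f⟩⟩,
    ⟨fun N s => WeakHopf.Cochain.diff k H N s,
      fun N => WeakHopf.Cochain.diff_comp_diff (N := N),
      WeakHopf.barCohomologyIso k, fun N => WeakHopf.Cochain.isBarCodifferential k H N,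
      fun N N' f => ⟨WeakHopf.Cochain.diff_comp_map k f,
        WeakHopf.barCohomologyIso_naturality f⟩⟩⟩
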